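/- **Conventions.** All groups other than those in universal properties are finite. Let $\ell$ be a prime and let $z\mapsto z^*$ be the reduction of algebraic integers in $\mathbb C$ modulo a fixed maximal ideal containing $\ell$ (so $z^*\in\overline{\mathbb F}_\ell$). Write $n_\ell$ and $n_{\ell'}$ for the $\ell$-part and $\ell'$-part of a positive integer $n$, $\mathrm{Irr}(G)$ for the set of irreducible complex characters, $\mathrm{Irr}(G\mid\nu)$ for the set of irreducible constituents of the character of $G$ induced by $\nu\in\mathrm{Irr}(N)$, $N\le G$, and $\mathrm{Irr}(N\mid\chi)$ for the set of irreducible constituents of $\mathrm{Res}^G_N\chi$. For a block $B$, $\lambda_B$ is its central character, i.e. $\lambda_B(\mathrm{Cl}(g)^+)=(|\mathrm{Cl}(g)|\chi(g)/\chi(1))^*$ for $\chi\in\mathrm{Irr}(B)$; $\mathrm{bl}(\chi)$ is the $\ell$-block containing $\chi$; $b^G$ is the Brauer-induced block, characterised (when it exists) by $\lambda_{b^G}(K^+)=\lambda_b((K\cap H)^+)$ for all classes $K$ of $G$, $b$ a block of $H\le G$. An equation involving $b^G$ includes the assertion that $b^G$ is defined. For an $\ell$-subgroup $D\le G$, $\mathrm{Irr}_0(G\mid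 D)$ is the set of $\chi\in\mathrm{Irr}(G)$ such that $\mathrm{bl}(\chi)$ has defect group $D$ and $\chi(1)_\ell=|G:D|_\ell$. An $\ell$-subgroup $D$ is radical if $D=O_\ell(N_G(D))$. Let $\mathrm{Aut}(G)_D$, $\mathrm{Aut}(G)_\chi$ and $\mathrm{Aut}(G)_{D,\chi}$ denote stabilizers. Let $S$ be a finite non-abelian simple group with universal covering group $G$, so that $S=G/\mathrm Z(G)$. For a non-central radical $\ell$-subgroup $D$ of $G$ consider the following conditions on a subgroup $M$ of $G$ and a map $\Omega_D$. (a) $M$ is $\mathrm{Aut}(G)_D$-stable and $N_G(D)\le M\lneq G$. (b) $\Omega_D:\mathrm{Irr}_0(G\mid D)\to\mathrm{Irr}_0(M\mid D)$ is an $\mathrm{Aut}(G)_D$-equivariant bijection such that $\Omega_D(\mathrm{Irr}_0(G\mid D)\cap\mathrm{Irr}(G\mid\nu))\subseteq\mathrm{Irr}(M\mid\nu)$ for every $\nu\in\mathrm{Irr}(\mathrm Z(G))$, and $\mathrm{bl}(\chi)=\mathrm{bl}(\Omega_D(\chi))^G$ for every $\chi\in\mathrm{Irr}_0(G\mid D)$.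 (c) For every $\chi\in\mathrm{Irr}_0(G\mid D)$, with $\chi':=\Omega_D(\chi)$, $Z:=\ker(\chi)\cap\mathrm Z(G)$, $\overline G:=G/Z$, $\overline M:=M/Z$ and $\overline D:=DZ/Z$, there are a finite group $A$ and characters $\widetilde\chi\in\mathrm{Irr}(A)$, $\widetilde\chi'\in\mathrm{Irr}(\overline M N_A(\overline D))$ such that - $\overline G\lhd A$, $C_A(\overline G)=\mathrm Z(A)$ and $A/\mathrm Z(A)\cong\mathrm{Aut}(G)_\chi$; - $\widetilde\chi$ extends the character of $\overline G$ that lifts to $\chi$, and $\widetilde\chi'$ extends the character of $\overline M$ that lifts to $\chi'$; - $\mathrm{bl}(\mathrm{Res}^A_J\widetilde\chi)=\mathrm{bl}\bigl(\mathrm{Res}^{\overline MN_A(\overline D)}_{\overline MN_J(\overline D)}\widetilde\chi'\bigr)^J$ for every $J$ with $\overline G\le J\le A$; - $\mathrm{Irr}(\mathrm Z(A)\mid\widetilde\chi)=\mathrm{Irr}(\mathrm Z(A)\mid\widetilde\chi')$. (c') For every $\chi\in\mathrm{Irr}_0(G\mid D)$, with $\chi':=\Omega_D(\chi)$ and $\widehat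 M:=M/\mathrm Z(G)$, where $G/\mathrm Z(G)$ is identified with the group of inner automorphisms of $G$, there are a section $\mathrm{rep}:G/\mathrm Z(G)\to G$ with $\mathrm{rep}(1)=1$, linear representations $\mathcal D$ of $G$ and $\mathcal D'$ of $M$ affording $\chi$ and $\chi'$, and complex projective representations $\mathcal P$ of $\mathrm{Aut}(G)_\chi$ and $\mathcal P'$ of $\widehat M\,\mathrm{Aut}(G)_{D,\chi}$, with factor sets $\alpha$, $\alpha'$ whose values are roots of unity, such that - $\mathcal P(s)=\mathcal D(\mathrm{rep}(s))$ for all $s\in G/\mathrm Z(G)$, and $\mathcal P'(m)=\mathcal D'(\mathrm{rep}(m))$ for all $m\in\widehat M$; - $\alpha'(a,a')=\alpha(a,a')$ for all $a,a'\in\widehat M\,\mathrm{Aut}(G)_{D,\chi}$; - $\epsilon_\chi^*\,\mathrm{tr}(\mathcal P(x))^*=\mathrm{tr}(\mathcal P'(x))^*$ for every $\ell$-regular $x\in\widehat M\,\mathrm{Aut}(G)_{D,\chi}$ such that $D\mathrm Z(G)/\mathrm Z(G)$ is a Sylow $\ell$-subgroup of $C_{G/\mathrm Z(G)}(x)$,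 where $\epsilon_\chi\in\{1,\dots,\ell-1\}$ is defined by $\epsilon_\chi\,\chi(1)_{\ell'}\equiv|G:M|_{\ell'}\,\chi'(1)_{\ell'}\pmod\ell$. The *inductive AM-condition holds for $S$ with respect to $D\mathrm Z(G)/\mathrm Z(G)$* if there are $M$ and $\Omega_D$ satisfying (a), (b) and (c). *Späth's inductive AM-condition holds for $S$ and $\ell$* if for every non-central radical $\ell$-subgroup $D$ of $G$ there are $M$ and $\Omega_D$ satisfying (a), (b) and (c'). **Proposition.** If the inductive AM-condition holds for $S$ with respect to every (non-trivial) radical $\ell$-subgroup of $S$, i.e. with respect to $D\mathrm Z(G)/\mathrm Z(G)$ for every non-central radical $\ell$-subgroup $D$ of $G$, then Späth's inductive AM-condition holds for $S$ and $\ell$. -/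

import Mathlib

universe u v w

noncomputable section

open scoped Classical

namespace InductiveAM

/-! ### Finite group theory -/

section Groups

variable {G : Type u} [Group G]

/-- `O_p(G)`, the largest normal `p`-subgroup of a finite group `G`. -/
def opCore (p : ℕ) (G : Type u) [Group G] : Subgroup G :=
  sSup {N : Subgroup G | N.Normal ∧ IsPGroup p N}

/-- `D` is a radical `p`-subgroup of `G`: a `p`-subgroup with `D = O_p(N_G(D))`. -/
def IsRadical (p : ℕ) (D : Subgroup G) : Prop :=
  IsPGroup p D ∧
    D = (opCore p (Subgroup.normalizer (D : Set G))).map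
      (Subgroup.normalizer (D : Set G)).subtype

/-- `P` is a Sylow `p`-subgroup of the subgroup `H` of `G`. -/
def IsSylowIn (p : ℕ) (P H : Subgroup G) : Prop :=
  ∃ T : Sylow p H, (T : Subgroup H).map H.subtype = P

/-- `π : G → S` is a central extension of `S`. -/
def IsCentralExtension {G : Type u} {S : Type v} [Group G] [Group S] (π : G →* S) : Prop :=
  Function.Surjective π ∧ π.ker ≤ Subgroup.center G

/-- `π : G → S` makes `G` the universal covering group of `S`, i.e. `π` is the universal central
extension of `S`. -/
def IsUniversalCover {G S : Type u} [Group G] [Group S] (π : G →* S) : Prop :=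
  IsCentralExtension π ∧
    ∀ (E : Type u) [Group E] (q : E →* S), IsCentralExtension q →
      ∃! h : G →* E, q.comp h = π

/-- `Aut(G)_D`, the stabilizer of the subgroup `D` in the automorphism group. -/
def autStab (D : Subgroup G) : Subgroup (MulAut G) where
  carrier := {a | ∀ g, a g ∈ D ↔ g ∈ D}
  mul_mem' := fun {a b} ha hb g => by
    rw [MulAut.mul_apply, ha, hb]
  one_mem' := fun g => by simp
  inv_mem' := fun {a} ha g => by
    rw [← ha (a⁻¹ g), MulAut.apply_inv_self]

/-- `Aut(G)_χ`, the stabilizer of the function `χ` on `G` in the automorphism group. -/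
def autStabChar (χ : G → ℂ) : Subgroup (MulAut G) where
  carrier := {a | ∀ g, χ (a g) = χ g}
  mul_mem' := fun {a b} ha hb g => by
    rw [MulAut.mul_apply, ha, hb]
  one_mem' := fun g => by simp
  inv_mem' := fun {a} ha g => by
    rw [← ha (a⁻¹ g), MulAut.apply_inv_self]

end Groups

/-! ### Ordinary characters -/

section Characters

variable {G : Type u} [Group G] {H : Type v} [Group H]

/-- `Irr(G)`, the set of irreducible complex characters of `G`. -/
def Irr (G : Type u) [Group G] : Set (G → ℂ) :=
  {χ | ∃ (n : ℕ) (ρ : Representation ℂ G (Fin n → ℂ)), ρ.IsIrreducible ∧ ρ.character = χ}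

/-- The scalar product `(1/|G|) ∑ φ(g) ψ(g⁻¹)`; for characters this is the usual hermitian one. -/
def charInner (φ ψ : G → ℂ) : ℂ :=
  (Nat.card G : ℂ)⁻¹ * ∑ᶠ g : G, φ g * ψ g⁻¹

/-- The induced character `Ind ν` along an embedding `f : H → G`:
`g ↦ (1/|H|) ∑_{x ∈ G} ν°(x⁻¹ g x)`, where `ν°` is `ν` extended by `0` outside of `H`. -/
def indChar (f : H →* G) (ν : H → ℂ) (g : G) : ℂ :=
  (Nat.card H : ℂ)⁻¹ * ∑ᶠ x : G, ∑ᶠ h ∈ {h : H | f h = x⁻¹ * g * x}, ν h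

/-- `Irr(G | ν)` for `ν ∈ Irr(H)` and an embedding `f : H → G`: the irreducible constituents of
the induced character. -/
def irrAbove (f : H →* G) (ν : H → ℂ) : Set (G → ℂ) :=
  {χ | χ ∈ Irr G ∧ charInner (indChar f ν) χ ≠ 0}

/-- `Irr(H | χ)` for `χ ∈ Irr(G)` and an embedding `f : H → G`: the irreducible constituents of
the restricted character. -/
def irrBelow (f : H →* G) (χ : G → ℂ) : Set (H → ℂ) :=
  {ν | ν ∈ Irr H ∧ charInner (fun h => χ (f h)) ν ≠ 0}

end Characters

/-! ### Blocks

Throughout, `𝔪` is a maximal ideal above `ℓ` of the ring of algebraic integers in `ℂ`; its residue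
field is an algebraic closure of the field with `ℓ` elements. -/

section Blocks

/-- The ring of algebraic integers in `ℂ`. -/
abbrev AlgInt : Type := integralClosure ℤ ℂ

/-- Reduction `z ↦ z^*` of algebraic integers modulo `𝔪` (with the value `0` elsewhere). -/
def red (𝔪 : Ideal AlgInt) (z : ℂ) : AlgInt ⧸ 𝔪 :=
  if h : z ∈ integralClosure ℤ ℂ then Ideal.Quotient.mk 𝔪 ⟨z, h⟩ else 0

variable (𝔪 : Ideal AlgInt) {G : Type u} [Group G] {H : Type v} [Group H]

/-- The value `λ_χ(K⁺) = (|K| χ(g) / χ(1))^*`, `g ∈ K`, of the central character of `χ` at the sum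
of the conjugacy class `K`. -/
def lam (χ : G → ℂ) (K : ConjClasses G) : AlgInt ⧸ 𝔪 :=
  red 𝔪 ((K.carrier.ncard : ℂ) * χ (Quotient.out K) / χ 1)

/-- `λ_χ` on an element `z` of the centre of the group algebra, by linear extension from the class
sums. -/
def lamLin (χ : G → ℂ) (z : MonoidAlgebra (AlgInt ⧸ 𝔪) G) : AlgInt ⧸ 𝔪 :=
  ∑ᶠ K : ConjClasses G, z.coeff (Quotient.out K) * lam 𝔪 χ K

/-- `bl(χ)`, the `ℓ`-block containing `χ`. A block is represented by the set of the ordinary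
irreducible characters in it, i.e. of those with a given `λ_χ`. -/
def bl (χ : G → ℂ) : Set (G → ℂ) :=
  {ψ | ψ ∈ Irr G ∧ lam 𝔪 ψ = lam 𝔪 χ}

/-- `Bl(G)`, the set of `ℓ`-blocks of `G`. -/
def Bl (G : Type u) [Group G] : Set (Set (G → ℂ)) :=
  bl 𝔪 '' Irr G

/-- `b^G = B` for a block `b` of `H` and an embedding `f : H → G`: the (Brauer-)induced block `b^G`
is defined and equals `B`, that is `λ_B(K⁺) = λ_b((K ∩ H)⁺)` for all conjugacy classes `K` of
`G`. -/
def IsInducedBlock (f : H →* G) (b : Set (H → ℂ)) (B : Set (G → ℂ)) : Prop :=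
  b ∈ Bl 𝔪 H ∧ B ∈ Bl 𝔪 G ∧
    ∀ ψ ∈ b, ∀ χ ∈ B, ∀ K : ConjClasses G,
      lam 𝔪 χ K = ∑ᶠ L ∈ {L : ConjClasses H | L.map f = K}, lam 𝔪 ψ L

/-- `e` is the block idempotent `e_B`: the central idempotent of the group algebra with
`λ_B(e) = 1` and `λ_{B'}(e) = 0` for all other blocks `B'`. -/
def IsBlockIdempotent (B : Set (G → ℂ)) (e : MonoidAlgebra (AlgInt ⧸ 𝔪) G) : Prop :=
  e ∈ Subalgebra.center (AlgInt ⧸ 𝔪) (MonoidAlgebra (AlgInt ⧸ 𝔪) G) ∧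
    IsIdempotentElem e ∧
    ∀ ψ ∈ Irr G, lamLin 𝔪 ψ e = if ψ ∈ B then 1 else 0

/-- `D` is a defect group of the block `B`: for a defect class of `B`, i.e. the class of some `x`
with `λ_B(Cl(x)⁺) ≠ 0` at which the coefficient of `e_B` is nonzero, `D` is a Sylow
`ℓ`-subgroup of `C_G(x)`. -/
def IsDefectGroup (ℓ : ℕ) (B : Set (G → ℂ)) (D : Subgroup G) : Prop :=
  B ∈ Bl 𝔪 G ∧ ∃ e, IsBlockIdempotent 𝔪 B e ∧
    ∃ x : G, e.coeff x ≠ 0 ∧ (∀ χ ∈ B, lam 𝔪 χ (ConjClasses.mk x) ≠ 0) ∧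
      IsSylowIn ℓ D (Subgroup.centralizer {x})

/-- `Irr_0(G | D)`: the `χ ∈ Irr(G)` in a block with defect group `D` with
`χ(1)_ℓ = |G : D|_ℓ`. -/
def Irr0 (ℓ : ℕ) (D : Subgroup G) : Set (G → ℂ) :=
  {χ | χ ∈ Irr G ∧ IsDefectGroup 𝔪 ℓ (bl 𝔪 χ) D ∧
    ∃ d : ℕ, χ 1 = d ∧ ordProj[ℓ] d = ordProj[ℓ] D.index}

end Blocks

/-! ### The inductive AM-condition -/

section AM

variable (ℓ : ℕ) (𝔪 : Ideal AlgInt) {G : Type u} [Group G]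

/-- Parts (a) and (b), common to both versions of the condition: `M` is a suitable overgroup of
`N_G(D)`, and `Ω` is a suitable bijection `Irr_0(G | D) → Irr_0(M | D)`. -/
structure IsAMBijection (D M : Subgroup G) (Ω : (G → ℂ) → (M → ℂ)) : Prop where
  stable : ∀ a ∈ autStab D, ∀ m ∈ M, a m ∈ M
  normalizer_le : Subgroup.normalizer (D : Set G) ≤ M
  ne_top : M ≠ ⊤
  bijOn : Set.BijOn Ω (Irr0 𝔪 ℓ D) (Irr0 𝔪 ℓ (D.subgroupOf M))
  equivariant : ∀ a ∈ autStab D, ∀ χ ∈ Irr0 𝔪 ℓ D, ∀ m m' : M, (m' : G) = a (m : G) →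
    Ω (fun g => χ (a⁻¹ g)) m' = Ω χ m
  central : ∀ ν ∈ Irr (Subgroup.center G), ∀ χ ∈ Irr0 𝔪 ℓ D,
    χ ∈ irrAbove (Subgroup.center G).subtype ν →
    Ω χ ∈ irrAbove
      (Subgroup.inclusion ((Subgroup.center_le_normalizer (D : Set G)).trans normalizer_le)) ν
  block : ∀ χ ∈ Irr0 𝔪 ℓ D, IsInducedBlock 𝔪 M.subtype (bl 𝔪 (Ω χ)) (bl 𝔪 χ)

section Local

variable {A : Type w} [Group A] (ι : G →* A) (D M : Subgroup G)

/-- `M̄ N_J(D̄)` for a subgroup `J` of `A`, where `M̄`, `D̄` are the images of `M`, `D` in `A`. -/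
def localSubgroup (J : Subgroup A) : Subgroup A :=
  M.map ι ⊔ (Subgroup.normalizer (D.map ι : Set A) ⊓ J)

theorem localSubgroup_le {J : Subgroup A} (hJ : ι.range ≤ J) : localSubgroup ι D M J ≤ J :=
  sup_le ((Subgroup.map_le_range ι M).trans hJ) inf_le_right

theorem localSubgroup_le_top (J : Subgroup A) :
    localSubgroup ι D M J ≤ localSubgroup ι D M ⊤ :=
  sup_le_sup_left (inf_le_inf_left _ le_top) _

theorem center_le_localSubgroup : Subgroup.center A ≤ localSubgroup ι D M ⊤ :=
  (le_inf (Subgroup.center_le_normalizer _) le_top).trans le_sup_right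

theorem map_le_localSubgroup (J : Subgroup A) : M.map ι ≤ localSubgroup ι D M J :=
  le_sup_left

end Local

/-- Part (c) of the relative condition, through extensions of ordinary characters.
The group `Ḡ = G / Z`, `Z = ker χ ∩ Z(G)`, is embedded in `A` by the homomorphism `ι : G → A` with
kernel `Z`. The characters `ext`, `ext'` are `χ̃ ∈ Irr(A)` and `χ̃' ∈ Irr(M̄ N_A(D̄))`. -/
def ExtensionCondition {G : Type u} [Group G] (D M : Subgroup G) (χ : G → ℂ) (χ' : M → ℂ) :
    Prop :=
  ∃ (A : Type u) (_ : Group A) (_ : Finite A) (ι : G →* A),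
    (∀ g, g ∈ ι.ker ↔ g ∈ Subgroup.center G ∧ χ g = χ 1) ∧
    ι.range.Normal ∧
    Subgroup.centralizer (ι.range : Set A) = Subgroup.center A ∧
    Nonempty ((A ⧸ Subgroup.center A) ≃* autStabChar χ) ∧
    ∃ ext ∈ Irr A, ∃ ext' ∈ Irr (localSubgroup ι D M ⊤),
      (∀ g, ext (ι g) = χ g) ∧
      (∀ m : M, ext' ⟨ι m, map_le_localSubgroup ι D M ⊤ (Subgroup.mem_map_of_mem ι m.2)⟩ = χ' m) ∧
      (∀ (J : Subgroup A) (hJ : ι.range ≤ J),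
        IsInducedBlock 𝔪 (Subgroup.inclusion (localSubgroup_le ι D M hJ))
          (bl 𝔪 fun h => ext' (Subgroup.inclusion (localSubgroup_le_top ι D M J) h))
          (bl 𝔪 fun j : J => ext j)) ∧
      irrBelow (Subgroup.center A).subtype ext =
        irrBelow (Subgroup.inclusion (center_le_localSubgroup ι D M)) ext'

/-- The **inductive AM-condition for `S` with respect to `Q = D Z(G) / Z(G)`**, where
`π : G → S` is the universal covering group and `D` is a non-central radical `ℓ`-subgroup
of `G`. (Such a `D` is uniquely determined by its image `Q` in `S`.) -/
def RelativeInductiveAM {S : Type u} [Group S] (π : G →* S) (Q : Subgroup S) : Prop :=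
  ∀ D : Subgroup G, IsRadical ℓ D → ¬ D ≤ Subgroup.center G → D.map π = Q →
    ∃ (M : Subgroup G) (Ω : (G → ℂ) → (M → ℂ)), IsAMBijection ℓ 𝔪 D M Ω ∧
      ∀ χ ∈ Irr0 𝔪 ℓ D, ExtensionCondition 𝔪 D M χ (Ω χ)

/-- `P` is a projective representation of the subgroup `X` of `B` with factor set `α`, and the
factor set has finite order, i.e. its values are roots of unity. (Only the values of `P` and `α`
on `X` matter.) -/
def IsProjRepOn {B : Type v} [Group B] {n : ℕ} (X : Subgroup B)
    (P : B → (Module.End ℂ (Fin n → ℂ))ˣ) (α : B → B → ℂ) : Prop :=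
  ∀ a ∈ X, ∀ b ∈ X,
    (P a : Module.End ℂ (Fin n → ℂ)) * (P b : Module.End ℂ (Fin n → ℂ)) =
      α a b • (P (a * b) : Module.End ℂ (Fin n → ℂ)) ∧
    ∃ k : ℕ, 0 < k ∧ α a b ^ k = 1

/-- `M̂ Aut(G)_{D,χ}` as a subgroup of `Aut(G)`, where `M̂ = M / Z(G)` acts by conjugation. -/
def localAut (D M : Subgroup G) (χ : G → ℂ) : Subgroup (MulAut G) :=
  M.map MulAut.conj ⊔ (autStab D ⊓ autStabChar χ)

/-- Part (c) of Späth's condition, through projective representations. The group `G / Z(G)` is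
identified with the group of inner automorphisms of `G`. -/
def ProjectiveCondition (D M : Subgroup G) (χ : G → ℂ) (χ' : M → ℂ) : Prop :=
  ∃ (n n' : ℕ) (rep : G ⧸ Subgroup.center G → G)
    (ρ : Representation ℂ G (Fin n → ℂ)) (ρ' : Representation ℂ M (Fin n' → ℂ))
    (P : MulAut G → (Module.End ℂ (Fin n → ℂ))ˣ)
    (P' : MulAut G → (Module.End ℂ (Fin n' → ℂ))ˣ)
    (α α' : MulAut G → MulAut G → ℂ),
    (∀ s, (rep s : G ⧸ Subgroup.center G) = s) ∧ rep 1 = 1 ∧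
    ρ.character = χ ∧ ρ'.character = χ' ∧
    IsProjRepOn (autStabChar χ) P α ∧
    IsProjRepOn (localAut D M χ) P' α' ∧
    (∀ g : G, (P (MulAut.conj g) : Module.End ℂ (Fin n → ℂ)) = ρ (rep g)) ∧
    (∀ m m' : M, (m' : G) = rep (m : G) →
      (P' (MulAut.conj (m : G)) : Module.End ℂ (Fin n' → ℂ)) = ρ' m') ∧
    (∀ a ∈ localAut D M χ, ∀ b ∈ localAut D M χ, α' a b = α a b) ∧
    ∃ ε : ℕ, 1 ≤ ε ∧ ε < ℓ ∧
      ε * ordCompl[ℓ] n ≡ ordCompl[ℓ] M.index * ordCompl[ℓ] n' [MOD ℓ] ∧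
      ∀ x ∈ localAut D M χ, (orderOf x).Coprime ℓ →
        IsSylowIn ℓ (D.map MulAut.conj)
          ((MulAut.conj : G →* MulAut G).range ⊓ Subgroup.centralizer {x}) →
        (ε : AlgInt ⧸ 𝔪) * red 𝔪 (LinearMap.trace ℂ _ (P x : Module.End ℂ (Fin n → ℂ))) =
          red 𝔪 (LinearMap.trace ℂ _ (P' x : Module.End ℂ (Fin n' → ℂ)))

/-- **Späth's inductive AM-condition** for a simple group with universal covering group `G` and
the prime `ℓ`. -/
def InductiveAMCondition (G : Type u) [Group G] : Prop :=
  ∀ D : Subgroup G, IsRadical ℓ D → ¬ D ≤ Subgroup.center G →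
    ∃ (M : Subgroup G) (Ω : (G → ℂ) → (M → ℂ)), IsAMBijection ℓ 𝔪 D M Ω ∧
      ∀ χ ∈ Irr0 𝔪 ℓ D, ProjectiveCondition ℓ 𝔪 D M χ (Ω χ)

end AM

end InductiveAM

end

/-!
Fix `D`, a character `χ` of height zero with defect group `D`, its image `χ'`, and the group
`A` containing `Ḡ = G/Z` with the extensions `χ̃ ∈ Irr(A)` and `χ̃' ∈ Irr(M̄ N_A(D̄))`. The
subgroup `M` and the bijection are kept, as the image of `D` in `S` is radical
(`IsRadical.map`); only the third condition has to be translated.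

*Projective representations.* By the universal property of the covering group, the
conjugation action of `A` on `Ḡ` lifts to a homomorphism `A → Aut(G)` with kernel `C_A(Ḡ) =
Z(A)` (`IsUniversalCover.exists_autHom`). Its image fixes `χ`, and since `A/Z(A) ≅ Aut(G)_χ`
a comparison of orders shows that it is all of `Aut(G)_χ`. Composing representations
affording `χ̃` and `χ̃'` with a section `s` of `A → Aut(G)_χ` which extends `rep` on inner
automorphisms gives the projective representations `P` and `P'`. Their factor sets are the
central characters of the two representations evaluated at `s(x) s(y) s(xy)⁻¹ ∈ Z(A)`; they
coincide because `χ̃` and `χ̃'` lie over the same character of `Z(A)`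
(`projectiveCondition_of_extensionCondition`).

*The congruence.* Let `x` be `ℓ`-regular with the required Sylow condition. Up to a central
factor `s(x)` may be replaced by an `ℓ`-regular `a`, and then `D̄` is a Sylow `ℓ`-subgroup
of `C_Ḡ(a)` (`isSylowIn_lift`). The equality of blocks for `J = Ḡ⟨a⟩` equates the value of
the central character of `χ̃` at the class of `a` with the sum of the values for `χ̃'` at
the classes of `M̄ N_J(D̄)` that fuse to it. All of these except the class of `a` itself
contribute zero: if `y` contributes, then height zero forces `|C_M̄(y)|_ℓ = |D̄|`, and a
Sylow subgroup of this centralizer is conjugate in `M̄` to `D̄`, so that Sylow's theorem in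
`C_Ḡ(a)` makes `y` conjugate to `a` already in the local subgroup. Since the index of
`C_M̄(a)` in `C_Ḡ(a)` is congruent to `1` modulo `ℓ`, comparing class sizes with degrees
yields the congruence with the factor `ε` (`red_character_congr`).

*Conjugacy of the Sylow subgroup to `D̄`.* This is the one place where the theory of defect
groups enters (`exists_conj_le_of_red_character_ne_zero`). Multiplying by the block
idempotent `e` does not change the trace of `y`, so some `m` in the support of `e` is
centralized by the given `ℓ`-subgroup, as sums over non-trivial orbits of an `ℓ`-group
vanish. Moreover `e` is a multiple of the sum of a defect class, since that class sum is
invertible modulo nilpotent elements in the summand of `e`; the same orbit argument then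
moves the `ℓ`-subgroup into the defect group (`exists_conj_le_of_coeff_ne_zero`). That the
central characters `λ_B` detect nilpotency in the centre of the modular group algebra
follows by lifting to characteristic zero: the eigenvalues of a lift are its central
character values, so its minimal polynomial reduces to a power of `X`
(`isNilpotent_of_lamLin_eq_zero`).
-/

namespace InductiveAM

/-! ### Reduction modulo the maximal ideal -/

section Reduction

variable (𝔪 : Ideal AlgInt)

theorem red_coe (z : AlgInt) : red 𝔪 (z : ℂ) = Ideal.Quotient.mk 𝔪 z := by
  unfold red
  rw [dif_pos z.2]

theorem red_eq_mk {z : ℂ} (hz : IsIntegral ℤ z) : red 𝔪 z = Ideal.Quotient.mk 𝔪 ⟨z, hz⟩ :=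
  red_coe 𝔪 ⟨z, hz⟩

theorem red_mul {x y : ℂ} (hx : IsIntegral ℤ x) (hy : IsIntegral ℤ y) :
    red 𝔪 (x * y) = red 𝔪 x * red 𝔪 y := by
  rw [red_eq_mk 𝔪 hx, red_eq_mk 𝔪 hy, red_eq_mk 𝔪 (hx.mul hy), ← map_mul]
  rfl

theorem red_natCast (n : ℕ) : red 𝔪 (n : ℂ) = n := by
  have h := red_coe 𝔪 (n : AlgInt)
  simpa using h

theorem isIntegral_natCast (n : ℕ) : IsIntegral ℤ (n : ℂ) := by
  have h := isIntegral_algebraMap (R := ℤ) (A := ℂ) (x := (n : ℤ))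
  simpa using h

theorem isIntegral_of_ne_zero {z : ℂ} (hz : red 𝔪 z ≠ 0) : IsIntegral ℤ z := by
  by_contra h
  exact hz (dif_neg h)

/-- A natural number vanishes in the residue field exactly when it is divisible by `ℓ`. -/
theorem natCast_residue_eq_zero_iff [h𝔪' : 𝔪.IsMaximal] {ℓ : ℕ} (hℓ : ℓ.Prime)
    (h𝔪 : (ℓ : AlgInt) ∈ 𝔪) (n : ℕ) : (n : AlgInt ⧸ 𝔪) = 0 ↔ ℓ ∣ n := by
  have hl : (ℓ : AlgInt ⧸ 𝔪) = 0 := by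
    have := Ideal.Quotient.eq_zero_iff_mem.2 h𝔪
    simpa using this
  constructor
  · intro hn
    by_contra hd
    have hc : IsCoprime (ℓ : ℤ) n := Nat.isCoprime_iff_coprime.2 ((hℓ.coprime_iff_not_dvd).2 hd)
    obtain ⟨a, b, hab⟩ := hc
    have := congrArg (Int.cast : ℤ → AlgInt ⧸ 𝔪) hab
    push_cast at this
    rw [hl, hn] at this
    have : Nontrivial (AlgInt ⧸ 𝔪) := Ideal.Quotient.nontrivial_iff.2 h𝔪'.ne_top
    simp at *
  · rintro ⟨k, rfl⟩
    push_cast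
    rw [hl, zero_mul]

end Reduction

/-! ### Representations and integrality -/

section Representations

variable {G : Type u} [Group G] {n : ℕ}

theorem isIntegral_of_pow_eq_one {z : ℂ} {k : ℕ} (hk : k ≠ 0) (h : z ^ k = 1) :
    IsIntegral ℤ z :=
  IsIntegral.of_pow (Nat.pos_of_ne_zero hk) (h ▸ isIntegral_one)

theorem isIntegral_character [Finite G] (ρ : Representation ℂ G (Fin n → ℂ)) (g : G) :
    IsIntegral ℤ (ρ.character g) := by
  unfold Representation.character
  rw [Module.End.trace_eq_sum_roots_charpoly_of_splits (IsAlgClosed.splits _)]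
  refine IsIntegral.multiset_sum fun z hz => ?_
  have hz' : Module.End.HasEigenvalue (ρ g) z := by
    rw [Module.End.hasEigenvalue_iff_isRoot_charpoly]
    exact (Polynomial.mem_roots'.1 hz).2
  obtain ⟨v, hv⟩ := hz'.exists_hasEigenvector
  refine isIntegral_of_pow_eq_one (orderOf_pos g).ne' (k := orderOf g) ?_
  have h1 := hv.pow_apply (orderOf g)
  rw [← map_pow, pow_orderOf_eq_one, map_one, Module.End.one_apply] at h1
  have h2 : (z ^ orderOf g - 1) • v = 0 := by rw [sub_smul, ← h1, one_smul, sub_self]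
  exact sub_eq_zero.1 ((smul_eq_zero.1 h2).resolve_right hv.2)

theorem character_one_eq (ρ : Representation ℂ G (Fin n → ℂ)) : ρ.character 1 = n := by
  rw [Representation.char_one]; simp

theorem one_ne_zero_of_mem_Irr {χ : G → ℂ} (hχ : χ ∈ Irr G) : χ 1 ≠ 0 := by
  obtain ⟨m, ρ, hρ, rfl⟩ := hχ
  rw [character_one_eq]
  rcases Nat.eq_zero_or_pos m with rfl | hm
  · exfalso
    obtain ⟨a, b, hab⟩ := hρ.exists_pair_ne
    refine hab (SetLike.ext fun x => ?_)
    rw [Subsingleton.elim x 0]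
    exact iff_of_true a.toSubmodule.zero_mem b.toSubmodule.zero_mem
  · exact_mod_cast hm.ne'

theorem ne_zero_of_character_mem_Irr {ρ : Representation ℂ G (Fin n → ℂ)}
    (hρ : ρ.character ∈ Irr G) : n ≠ 0 := by
  have := one_ne_zero_of_mem_Irr hρ
  rw [character_one_eq] at this
  exact_mod_cast this

/-- **Schur's lemma** for a representation whose character is irreducible: since the space of
endomorphisms has dimension `⟨χ, χ⟩ = 1`, no irreducibility of `ρ` itself has to be known. -/
theorem exists_eq_smul_one_of_commute [Finite G] {ρ : Representation ℂ G (Fin n → ℂ)}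
    (hρ : ρ.character ∈ Irr G) (T : Module.End ℂ (Fin n → ℂ))
    (hT : ∀ g, T * ρ g = ρ g * T) : ∃ c : ℂ, T = c • 1 := by
  have hn := ne_zero_of_character_mem_Irr hρ
  obtain ⟨m, σ, hσ, hσρ⟩ := hρ
  have : Fintype G := Fintype.ofFinite G
  have hG : (Nat.card G : ℂ) ≠ 0 := by exact_mod_cast Nat.card_pos.ne'
  have : Invertible (Nat.card G : ℂ) := invertibleOfNonzero hG
  have h1 := Representation.card_inv_mul_sum_char_mul_char_eq_finrank ρ ρ
  have h2 := Representation.card_inv_mul_sum_char_mul_char_eq_finrank σ σ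
  rw [← hσρ, h2, Representation.IsIrreducible.finrank_intertwiningMap_self] at h1
  have h3 : Module.finrank ℂ (Representation.IntertwiningMap ρ ρ) = 1 := by exact_mod_cast h1.symm
  have hne : Representation.IntertwiningMap.id ρ ≠ 0 := by
    intro h0
    have h4 := congrArg (fun f => f (fun _ => (1 : ℂ)) ⟨0, Nat.pos_of_ne_zero hn⟩) h0
    simp at h4
  obtain ⟨c, hc⟩ := (finrank_eq_one_iff_of_nonzero' _ hne).1 h3
    ⟨T, fun g => by have := hT g; simpa [Module.End.mul_eq_comp] using this⟩
  refine ⟨c, ?_⟩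
  have := congrArg Representation.IntertwiningMap.toLinearMap hc
  refine LinearMap.ext fun v => ?_
  simpa using (LinearMap.congr_fun this.symm _)

/-- The extension of a complex representation to the group ring over the algebraic integers. -/
noncomputable def intAlgHom (ρ : Representation ℂ G (Fin n → ℂ)) :
    MonoidAlgebra AlgInt G →ₐ[AlgInt] Module.End ℂ (Fin n → ℂ) :=
  MonoidAlgebra.lift AlgInt _ G ρ

theorem intAlgHom_apply [Fintype G] (ρ : Representation ℂ G (Fin n → ℂ))
    (z : MonoidAlgebra AlgInt G) :
    intAlgHom ρ z = ∑ g, ((z.coeff g : AlgInt) : ℂ) • ρ g := by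
  unfold intAlgHom
  rw [MonoidAlgebra.lift_apply, Finsupp.sum_fintype _ _ (by simp)]
  rfl

theorem isIntegral_of_intAlgHom_eq [Finite G] (ρ : Representation ℂ G (Fin n → ℂ)) (hn : n ≠ 0)
    {z : MonoidAlgebra AlgInt G} {c : ℂ} (h : intAlgHom ρ z = c • 1) : IsIntegral ℤ c := by
  have : Module.Finite AlgInt (MonoidAlgebra AlgInt G) := inferInstance
  have h1 : IsIntegral AlgInt z := IsIntegral.of_finite AlgInt z
  have h2 := h1.map (intAlgHom ρ)
  have : NeZero n := ⟨hn⟩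
  rw [h, ← Algebra.algebraMap_eq_smul_one] at h2
  have h3 : IsIntegral AlgInt c := by
    refine (isIntegral_algHom_iff (IsScalarTower.toAlgHom AlgInt ℂ
      (Module.End ℂ (Fin n → ℂ))) ?_).1 h2
    exact (algebraMap ℂ (Module.End ℂ (Fin n → ℂ))).injective
  exact isIntegral_trans (R := ℤ) (A := AlgInt) c h3

end Representations

/-! ### Central characters of the group ring -/

section CentralCharacters

variable {G : Type u} [Group G] {n : ℕ}

theorem mem_center_iff_coeff {R : Type*} [CommRing R] {z : MonoidAlgebra R G} :
    z ∈ Subalgebra.center R (MonoidAlgebra R G) ↔ ∀ g h, z.coeff (h * g * h⁻¹) = z.coeff g := by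
  constructor
  · intro hz g h
    have h1 := Subalgebra.mem_center_iff.1 hz (MonoidAlgebra.single h 1)
    have h2 := congrArg (fun y => y.coeff (h * g)) h1
    simp at h2
    exact h2.symm
  · intro hz
    rw [Subalgebra.mem_center_iff]
    intro b
    induction b using MonoidAlgebra.induction_linear with
    | zero => simp
    | add f g hf hg => rw [add_mul, mul_add, hf, hg]
    | single h r =>
      ext g
      simp
      rw [← hz (h⁻¹ * g) h, mul_comm]
      congr 2
      group

variable (𝔪 : Ideal AlgInt)

/-- The coefficients of a central element are constant on classes, so they can be lifted
compatibly. -/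
theorem exists_center_lift [Finite G] {z : MonoidAlgebra (AlgInt ⧸ 𝔪) G}
    (hz : z ∈ Subalgebra.center (AlgInt ⧸ 𝔪) (MonoidAlgebra (AlgInt ⧸ 𝔪) G)) :
    ∃ y ∈ Subalgebra.center AlgInt (MonoidAlgebra AlgInt G),
      MonoidAlgebra.mapRingHom G (Ideal.Quotient.mk 𝔪) y = z := by
  rw [mem_center_iff_coeff] at hz
  refine ⟨MonoidAlgebra.ofCoeff
    (Finsupp.equivFunOnFinite.symm fun g => Quotient.out (z.coeff g)), ?_, ?_⟩
  · rw [mem_center_iff_coeff]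
    intro g h
    simp [hz]
  · ext g
    simp

/-- An element of the group ring which commutes with a subgroup that already acts with an
irreducible character acts as an algebraic integer. -/
theorem exists_intAlgHom_eq_smul_one [Finite G] {N : Type v} [Group N] [Finite N] (j : N →* G)
    {ρ : Representation ℂ G (Fin n → ℂ)} (hρ : (fun x => ρ.character (j x)) ∈ Irr N)
    {z : MonoidAlgebra AlgInt G}
    (hz : ∀ x, z * MonoidAlgebra.single (j x) 1 = MonoidAlgebra.single (j x) 1 * z) :
    ∃ c : AlgInt, intAlgHom ρ z = (c : ℂ) • 1 := by
  have hσ : Representation.character (ρ.comp j : Representation ℂ N (Fin n → ℂ)) ∈ Irr N := hρ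
  have hn := ne_zero_of_character_mem_Irr hσ
  obtain ⟨c, hc⟩ := exists_eq_smul_one_of_commute hσ (intAlgHom ρ z) fun x => by
    have h1 := congrArg (intAlgHom ρ) (hz x)
    rw [map_mul, map_mul] at h1
    simpa [intAlgHom] using h1
  exact ⟨⟨c, isIntegral_of_intAlgHom_eq ρ hn hc⟩, hc⟩

/-- The trace computes the scalar by which a central element acts. -/
theorem natCast_mul_scalar_eq [Fintype G] {ρ : Representation ℂ G (Fin n → ℂ)}
    {z : MonoidAlgebra AlgInt G} {c : ℂ} (h : intAlgHom ρ z = c • 1) :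
    n * c = ∑ g, ((z.coeff g : AlgInt) : ℂ) * ρ.character g := by
  have h1 := congrArg (LinearMap.trace ℂ (Fin n → ℂ)) h
  rw [intAlgHom_apply, map_sum] at h1
  simp only [map_smul, smul_eq_mul, LinearMap.trace_one, Module.finrank_fin_fun] at h1
  rw [mul_comm, ← h1]
  rfl

/-- For a set `K` stable under conjugation by a subgroup that acts with an irreducible character,
on which the character has a constant value `c`, the number `|K| c / χ(1)` is integral. -/
theorem isIntegral_card_mul_div [Finite G] {N : Type v} [Group N] [Finite N] (j : N →* G)
    {ρ : Representation ℂ G (Fin n → ℂ)} (hρ : (fun x => ρ.character (j x)) ∈ Irr N)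
    {K : Set G} (hK : ∀ x, ∀ k ∈ K, j x * k * (j x)⁻¹ ∈ K) {c : ℂ}
    (hc : ∀ k ∈ K, ρ.character k = c) : IsIntegral ℤ (K.ncard * c / ρ.character 1) := by
  classical
  have : Fintype G := Fintype.ofFinite G
  have hσ : Representation.character (ρ.comp j : Representation ℂ N (Fin n → ℂ)) ∈ Irr N := hρ
  have hn := ne_zero_of_character_mem_Irr hσ
  let z : MonoidAlgebra AlgInt G :=
    MonoidAlgebra.ofCoeff (Finsupp.equivFunOnFinite.symm fun g => if g ∈ K then 1 else 0)
  obtain ⟨d, hd⟩ := exists_intAlgHom_eq_smul_one j hρ (z := z) fun x => by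
    ext g
    have h1 : g * (j x)⁻¹ ∈ K ↔ (j x)⁻¹ * g ∈ K := by
      constructor
      · intro h
        have := hK x⁻¹ _ h
        simpa [mul_assoc] using this
      · intro h
        have := hK x _ h
        simpa [mul_assoc] using this
    simp [z, h1]
  have h2 := natCast_mul_scalar_eq hd
  have h3 : ∑ g, ((z.coeff g : AlgInt) : ℂ) * ρ.character g = K.ncard * c := by
    have : ∀ g, ((z.coeff g : AlgInt) : ℂ) * ρ.character g = if g ∈ K then c else 0 := by
      intro g
      by_cases hg : g ∈ K
      · simp [z, hg, hc]
      · simp [z, hg]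
    simp_rw [this]
    rw [← Finset.sum_filter, Finset.sum_const, nsmul_eq_mul, Set.ncard_eq_toFinset_card']
    congr 3
    ext; simp
  rw [← h3, ← h2, character_one_eq, mul_div_cancel_left₀ _ (by exact_mod_cast hn)]
  exact d.2

theorem character_eq_of_mk_eq (ρ : Representation ℂ G (Fin n → ℂ)) {g h : G}
    (hgh : ConjClasses.mk g = ConjClasses.mk h) : ρ.character g = ρ.character h := by
  obtain ⟨c, hc⟩ := isConj_iff.1 (ConjClasses.mk_eq_mk_iff_isConj.1 hgh)
  rw [← hc, Representation.char_conj]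

theorem mk_out (K : ConjClasses G) : ConjClasses.mk (Quotient.out K) = K := Quotient.out_eq K

theorem coeff_eq_of_mk_eq {R : Type*} [CommRing R] {z : MonoidAlgebra R G}
    (hz : z ∈ Subalgebra.center R (MonoidAlgebra R G)) {g h : G}
    (hgh : ConjClasses.mk g = ConjClasses.mk h) : z.coeff g = z.coeff h := by
  obtain ⟨c, hc⟩ := isConj_iff.1 (ConjClasses.mk_eq_mk_iff_isConj.1 hgh)
  rw [← hc, mem_center_iff_coeff.1 hz]

/-- A central element of the integral group ring acts in an irreducible representation as an
algebraic integer whose reduction is the value of the central character of the block. -/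
theorem exists_scalar_lamLin [Finite G] {ρ : Representation ℂ G (Fin n → ℂ)}
    (hρ : ρ.character ∈ Irr G) {z : MonoidAlgebra AlgInt G}
    (hz : z ∈ Subalgebra.center AlgInt (MonoidAlgebra AlgInt G)) :
    ∃ c : AlgInt, intAlgHom ρ z = (c : ℂ) • 1 ∧
      Ideal.Quotient.mk 𝔪 c =
        lamLin 𝔪 ρ.character (MonoidAlgebra.mapRingHom G (Ideal.Quotient.mk 𝔪) z) := by
  classical
  have : Fintype G := Fintype.ofFinite G
  have hn := ne_zero_of_character_mem_Irr hρ
  obtain ⟨c, hc⟩ := exists_intAlgHom_eq_smul_one (MonoidHom.id G) hρ (z := z) fun x =>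
    (Subalgebra.mem_center_iff.1 hz _).symm
  refine ⟨c, hc, ?_⟩
  have hint : ∀ K : ConjClasses G, IsIntegral ℤ
      ((K.carrier.ncard : ℂ) * ρ.character (Quotient.out K) / ρ.character 1) := fun K =>
    isIntegral_card_mul_div (MonoidHom.id G) hρ (fun x k hk => by
      rw [ConjClasses.mem_carrier_iff_mk_eq] at hk ⊢
      rw [← hk, ConjClasses.mk_eq_mk_iff_isConj, isConj_comm]
      exact isConj_iff.2 ⟨x, rfl⟩) fun k hk => by
      rw [ConjClasses.mem_carrier_iff_mk_eq] at hk
      exact character_eq_of_mk_eq ρ (hk.trans (mk_out K).symm)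
  have h1 : (c : ℂ) = ∑ K : ConjClasses G, ((z.coeff (Quotient.out K) : AlgInt) : ℂ) *
      ((K.carrier.ncard : ℂ) * ρ.character (Quotient.out K) / ρ.character 1) := by
    have h2 := natCast_mul_scalar_eq hc
    rw [← Finset.sum_fiberwise (s := Finset.univ) (g := ConjClasses.mk)] at h2
    have hn' : (n : ℂ) ≠ 0 := by exact_mod_cast hn
    rw [← mul_div_cancel_left₀ (c : ℂ) hn', h2, Finset.sum_div]
    refine Finset.sum_congr rfl fun K _ => ?_
    rw [Finset.sum_congr rfl (g := fun _ => ((z.coeff (Quotient.out K) : AlgInt) : ℂ) *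
      ρ.character (Quotient.out K)) fun g hg => by
        have hg' : ConjClasses.mk g = ConjClasses.mk (Quotient.out K) :=
          (Finset.mem_filter.1 hg).2.trans (mk_out K).symm
        rw [coeff_eq_of_mk_eq hz hg', character_eq_of_mk_eq ρ hg']]
    rw [Finset.sum_const, nsmul_eq_mul, character_one_eq, Set.ncard_eq_toFinset_card']
    have : (Finset.univ.filter fun g => ConjClasses.mk g = K) = K.carrier.toFinset := by
      ext g; simp [ConjClasses.mem_carrier_iff_mk_eq]
    rw [this]
    ring
  have h2 : c = ∑ K : ConjClasses G, z.coeff (Quotient.out K) * ⟨_, hint K⟩ := by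
    apply Subtype.ext
    rw [h1]
    simp
  unfold lamLin
  rw [finsum_eq_sum_of_fintype, h2, map_sum]
  refine Finset.sum_congr rfl fun K _ => ?_
  rw [map_mul, MonoidAlgebra.coeff_mapRingHom]
  congr 1
  exact (red_eq_mk 𝔪 (hint K)).symm

theorem lamLin_mul [Finite G] {ψ : G → ℂ} (hψ : ψ ∈ Irr G)
    {y z : MonoidAlgebra (AlgInt ⧸ 𝔪) G}
    (hy : y ∈ Subalgebra.center (AlgInt ⧸ 𝔪) (MonoidAlgebra (AlgInt ⧸ 𝔪) G))
    (hz : z ∈ Subalgebra.center (AlgInt ⧸ 𝔪) (MonoidAlgebra (AlgInt ⧸ 𝔪) G)) :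
    lamLin 𝔪 ψ (y * z) = lamLin 𝔪 ψ y * lamLin 𝔪 ψ z := by
  obtain ⟨y', hy', rfl⟩ := exists_center_lift 𝔪 hy
  obtain ⟨z', hz', rfl⟩ := exists_center_lift 𝔪 hz
  have hψ' := hψ
  obtain ⟨n, ρ, -, rfl⟩ := hψ'
  have : NeZero n := ⟨ne_zero_of_character_mem_Irr hψ⟩
  obtain ⟨a, ha, ha'⟩ := exists_scalar_lamLin 𝔪 hψ hy'
  obtain ⟨b, hb, hb'⟩ := exists_scalar_lamLin 𝔪 hψ hz'
  obtain ⟨c, hc, hc'⟩ := exists_scalar_lamLin 𝔪 hψ (mul_mem hy' hz')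
  rw [← map_mul, ← ha', ← hb', ← hc', ← map_mul]
  congr 1
  apply Subtype.ext
  rw [map_mul, ha, hb, smul_mul_smul_comm, one_mul] at hc
  exact (smul_left_injective ℂ (one_ne_zero (α := Module.End ℂ (Fin n → ℂ))) hc).symm

theorem lamLin_sub [Finite G] (ψ : G → ℂ) (y z : MonoidAlgebra (AlgInt ⧸ 𝔪) G) :
    lamLin 𝔪 ψ (y - z) = lamLin 𝔪 ψ y - lamLin 𝔪 ψ z := by
  classical
  have : Fintype G := Fintype.ofFinite G
  unfold lamLin
  simp only [finsum_eq_sum_of_fintype, ← Finset.sum_sub_distrib]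
  refine Finset.sum_congr rfl fun K _ => ?_
  rw [MonoidAlgebra.coeff_sub, Finsupp.sub_apply, sub_mul]

end CentralCharacters

/-! ### Nilpotent elements of the centre of the modular group algebra -/

section Nilpotent

variable {G : Type u} [Group G]

/-- A simple left ideal of the complex group algebra affords an irreducible character. -/
theorem exists_irreducible_of_isSimpleModule [Finite G]
    (U : Submodule (MonoidAlgebra ℂ G) (MonoidAlgebra ℂ G))
    [hU : IsSimpleModule (MonoidAlgebra ℂ G) U] :
    ∃ (n : ℕ) (ρ : Representation ℂ G (Fin n → ℂ)) (e : (Fin n → ℂ) ≃ₗ[ℂ] U),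
      ρ.IsIrreducible ∧ ∀ r v, e (ρ.asAlgebraHom r v) = r • e v := by
  have : FiniteDimensional ℂ U :=
    FiniteDimensional.of_injective (U.subtype.restrictScalars ℂ) Subtype.val_injective
  let e : (Fin (Module.finrank ℂ U) → ℂ) ≃ₗ[ℂ] U := (Module.finBasis ℂ U).equivFun.symm
  let f : MonoidAlgebra ℂ G →ₐ[ℂ] Module.End ℂ (Fin (Module.finrank ℂ U) → ℂ) :=
    (e.symm.conjAlgEquiv ℂ).toAlgHom.comp (Algebra.lsmul ℂ ℂ U)
  let ρ : Representation ℂ G (Fin (Module.finrank ℂ U) → ℂ) :=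
    (MonoidAlgebra.lift ℂ _ G).symm f
  have hρ : ρ.asAlgebraHom = f := (MonoidAlgebra.lift ℂ _ G).apply_symm_apply f
  have he : ∀ r v, e (ρ.asAlgebraHom r v) = r • e v := by
    intro r v
    rw [hρ]
    simp [f]
  refine ⟨_, ρ, e, ?_, he⟩
  rw [Representation.irreducible_iff_isSimpleModule_asModule]
  let E : ρ.asModule ≃ₗ[MonoidAlgebra ℂ G] U :=
    { (ρ.asModuleEquiv.trans e).toAddEquiv with
      map_smul' := fun r v => by
        simpa using he r (ρ.asModuleEquiv v) }
  exact IsSimpleModule.congr E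

variable (𝔪 : Ideal AlgInt)

/-- An eigenvalue of a central element on the group algebra is the scalar by which it acts on a
simple left ideal. -/
theorem exists_scalar_of_eigenvector [Finite G] {y : MonoidAlgebra AlgInt G}
    (hy : y ∈ Subalgebra.center AlgInt (MonoidAlgebra AlgInt G)) {μ : ℂ} {v : MonoidAlgebra ℂ G}
    (hv : v ≠ 0)
    (h : MonoidAlgebra.mapRingHom G (algebraMap AlgInt ℂ) y * v = μ • v) :
    ∃ c : AlgInt, (c : ℂ) = μ ∧ ∃ ψ ∈ Irr G, Ideal.Quotient.mk 𝔪 c =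
        lamLin 𝔪 ψ (MonoidAlgebra.mapRingHom G (Ideal.Quotient.mk 𝔪) y) := by
  set Y := MonoidAlgebra.mapRingHom G (algebraMap AlgInt ℂ) y with hY
  have hYc : ∀ b, b * Y = Y * b := by
    refine (Subalgebra.mem_center_iff (R := ℂ)).1 (mem_center_iff_coeff.2 fun g k => ?_)
    simp [hY, mem_center_iff_coeff.1 hy]
  have : IsArtinian (MonoidAlgebra ℂ G) (MonoidAlgebra ℂ G) :=
    isArtinian_of_tower ℂ inferInstance
  obtain ⟨U, hU, hUv⟩ :=
    (eq_bot_or_exists_atom_le (Submodule.span (MonoidAlgebra ℂ G) {v})).resolve_left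
      (by simpa using hv)
  have : IsSimpleModule (MonoidAlgebra ℂ G) U := isSimpleModule_iff_isAtom.2 hU
  obtain ⟨n, ρ, e, hρ, he⟩ := exists_irreducible_of_isSimpleModule U
  have hχ : ρ.character ∈ Irr G := ⟨n, ρ, hρ, rfl⟩
  have : NeZero n := ⟨ne_zero_of_character_mem_Irr hχ⟩
  obtain ⟨c, hc, hc'⟩ := exists_scalar_lamLin 𝔪 hχ hy
  refine ⟨c, ?_, _, hχ, hc'⟩
  have h1 : ρ.asAlgebraHom Y = (c : ℂ) • 1 := by
    have : Fintype G := Fintype.ofFinite G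
    rw [← hc, intAlgHom_apply, Representation.asAlgebraHom_def, MonoidAlgebra.lift_apply,
      Finsupp.sum_fintype _ _ (by simp)]
    simp [hY]
  obtain ⟨x, hx⟩ := exists_ne (0 : Fin n → ℂ)
  have h2 := he Y x
  rw [h1] at h2
  obtain ⟨b, hb⟩ := Submodule.mem_span_singleton.1 (hUv (e x).2)
  have h3 : Y • e x = μ • e x := by
    apply Subtype.ext
    have : Y * (b * v) = μ • (b * v) := by
      rw [← mul_assoc, ← hYc, mul_assoc, h, mul_smul_comm]
    simpa [← hb] using this
  rw [h3] at h2
  have h4 : (c : ℂ) • (e x : MonoidAlgebra ℂ G) = μ • (e x : MonoidAlgebra ℂ G) := by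
    have := congrArg Subtype.val h2
    simpa using this
  have h5 : (e x : MonoidAlgebra ℂ G) ≠ 0 := by simpa using hx
  exact smul_left_injective ℂ h5 h4

/-- The central characters of the blocks detect nilpotency in the centre of the modular group
algebra: a lift of the element satisfies a polynomial whose roots all lie in the maximal ideal. -/
theorem isNilpotent_of_lamLin_eq_zero [Finite G] {z : MonoidAlgebra (AlgInt ⧸ 𝔪) G}
    (hz : z ∈ Subalgebra.center (AlgInt ⧸ 𝔪) (MonoidAlgebra (AlgInt ⧸ 𝔪) G))
    (h : ∀ ψ ∈ Irr G, lamLin 𝔪 ψ z = 0) : IsNilpotent z := by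
  classical
  obtain ⟨y, hy, rfl⟩ := exists_center_lift 𝔪 hz
  set Y := MonoidAlgebra.mapRingHom G (algebraMap AlgInt ℂ) y with hY
  have hYi : IsIntegral ℂ Y := IsIntegral.of_finite ℂ Y
  let f : ℂ → AlgInt := fun μ => if h : IsIntegral ℤ μ then ⟨μ, h⟩ else 0
  have hroot : ∀ μ ∈ (minpoly ℂ Y).roots, (f μ : ℂ) = μ ∧ Ideal.Quotient.mk 𝔪 (f μ) = 0 := by
    intro μ hμ
    obtain ⟨r, hr⟩ := Polynomial.dvd_iff_isRoot.2 (Polynomial.mem_roots'.1 hμ).2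
    have hr0 : r ≠ 0 := by
      rintro rfl
      exact minpoly.ne_zero hYi (by rw [hr, mul_zero])
    have hmonic : r.Monic :=
      (Polynomial.monic_X_sub_C μ).of_mul_monic_left (hr ▸ minpoly.monic hYi)
    have hv : Polynomial.aeval Y r ≠ 0 := by
      intro h0
      have h1 := minpoly.min ℂ Y hmonic h0
      rw [hr, Polynomial.degree_mul, Polynomial.degree_X_sub_C,
        Polynomial.degree_eq_natDegree hr0] at h1
      norm_cast at h1
      omega
    have hev : Y * Polynomial.aeval Y r = μ • Polynomial.aeval Y r := by
      have h1 := minpoly.aeval ℂ Y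
      rw [hr, map_mul, map_sub, Polynomial.aeval_X, Polynomial.aeval_C, sub_mul, sub_eq_zero] at h1
      rw [h1, Algebra.algebraMap_eq_smul_one, smul_mul_assoc, one_mul]
    obtain ⟨c, hc, ψ, hψ, hcψ⟩ := exists_scalar_of_eigenvector 𝔪 hy hv hev
    have : f μ = c := by
      apply Subtype.ext
      simp only [f]
      rw [dif_pos (hc ▸ c.2)]
      exact hc.symm
    rw [this, hcψ, h ψ hψ]
    exact ⟨hc, rfl⟩
  let q : Polynomial AlgInt :=
    ((minpoly ℂ Y).roots.map fun μ => Polynomial.X - Polynomial.C (f μ)).prod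
  have hq : q.map (algebraMap AlgInt ℂ) = minpoly ℂ Y := by
    conv_rhs => rw [(IsAlgClosed.splits (minpoly ℂ Y)).eq_prod_roots_of_monic (minpoly.monic hYi)]
    simp only [q, Polynomial.map_multiset_prod, Multiset.map_map]
    congr 1
    refine Multiset.map_congr rfl fun μ hμ => ?_
    simp [(hroot μ hμ).1]
  have hq' : q.map (Ideal.Quotient.mk 𝔪) = Polynomial.X ^ (minpoly ℂ Y).roots.card := by
    simp only [q, Polynomial.map_multiset_prod, Multiset.map_map]
    rw [Multiset.map_congr rfl (g := fun _ => Polynomial.X) fun μ hμ => by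
      simp [(hroot μ hμ).2]]
    simp
  have hqy : Polynomial.aeval y q = 0 := by
    have hinj : Function.Injective (MonoidAlgebra.mapRingHom G (algebraMap AlgInt ℂ)) := by
      intro a b hab
      ext g
      have := congrArg (fun x => x.coeff g) hab
      simpa using this
    apply hinj
    rw [map_zero, Polynomial.aeval_def, Polynomial.hom_eval₂]
    have h1 := minpoly.aeval ℂ Y
    rw [← hq, Polynomial.aeval_def, Polynomial.eval₂_map] at h1
    rw [← h1]
    congr 1
    ext1 a
    simp
  refine ⟨(minpoly ℂ Y).roots.card, ?_⟩
  have h1 := congrArg (MonoidAlgebra.mapRingHom G (Ideal.Quotient.mk 𝔪)) hqy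
  rw [map_zero, Polynomial.aeval_def, Polynomial.hom_eval₂] at h1
  have h2 : (MonoidAlgebra.mapRingHom G (Ideal.Quotient.mk 𝔪)).comp
      (algebraMap AlgInt (MonoidAlgebra AlgInt G)) =
      (algebraMap (AlgInt ⧸ 𝔪) (MonoidAlgebra (AlgInt ⧸ 𝔪) G)).comp (Ideal.Quotient.mk 𝔪) := by
    ext1 a
    simp
  rw [h2, ← Polynomial.eval₂_map, hq', Polynomial.eval₂_X_pow] at h1
  exact h1

end Nilpotent

/-! ### Defect groups -/

section DefectGroups

variable {G : Type u} [Group G]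

/-- In characteristic `ℓ`, only the fixed points of an `ℓ`-group contribute to the sum of an
invariant function. -/
theorem exists_commute_of_sum_ne_zero [Fintype G] {F : Type*} [CommRing F] {ℓ : ℕ}
    (hℓ : ℓ.Prime) (hF : (ℓ : F) = 0) {P : Subgroup G} (hP : IsPGroup ℓ P) (f : G → F)
    (hf : ∀ p ∈ P, ∀ g, f (p * g * p⁻¹) = f g) (h : ∑ g, f g ≠ 0) :
    ∃ g, f g ≠ 0 ∧ ∀ p ∈ P, p * g = g * p := by
  classical
  have : Fact ℓ.Prime := ⟨hℓ⟩
  by_contra! hcon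
  apply h
  let _ : MulAction P G := MulAction.compHom G (MulAut.conj.comp P.subtype)
  let q : G → MulAction.orbitRel.Quotient P G := Quotient.mk''
  rw [← Finset.sum_fiberwise (s := Finset.univ) (g := q)]
  refine Finset.sum_eq_zero fun ω _ => ?_
  induction ω using Quotient.inductionOn' with
  | h x =>
    have hfib : (Finset.univ.filter fun g => q g = Quotient.mk'' x) =
        (MulAction.orbit P x).toFinset := by
      ext g
      simp only [Finset.mem_filter, Finset.mem_univ, true_and, Set.mem_toFinset]
      exact Quotient.eq''.trans MulAction.orbitRel_apply
    rw [hfib, Finset.sum_congr rfl (g := fun _ => f x) fun g hg => by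
      obtain ⟨p, rfl⟩ := Set.mem_toFinset.1 hg
      exact hf p p.2 x]
    rw [Finset.sum_const, nsmul_eq_mul]
    by_cases hx : f x = 0
    · rw [hx, mul_zero]
    · obtain ⟨p, hp, hne⟩ := hcon x hx
      obtain ⟨k, hk⟩ := hP.card_orbit x
      have hk0 : k ≠ 0 := by
        rintro rfl
        rw [pow_zero] at hk
        have hs : Subsingleton (MulAction.orbit P x) := (Nat.card_eq_one_iff_unique.1 hk).1
        have h1 : p * x * p⁻¹ = x :=
          congrArg Subtype.val (hs.elim ⟨_, MulAction.mem_orbit x (⟨p, hp⟩ : P)⟩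
            ⟨x, MulAction.mem_orbit_self x⟩)
        exact hne (mul_inv_eq_iff_eq_mul.1 h1)
      have : ((MulAction.orbit P x).toFinset.card : F) = 0 := by
        rw [Set.toFinset_card, ← Nat.card_eq_fintype_card, hk]
        push_cast
        rw [hF, zero_pow hk0]
      rw [this, zero_mul]

/-- If `e w` is the identity modulo nilpotent elements in the summand `e R`, then `w` is
invertible there, so that `e` is a multiple of `w`. -/
theorem exists_eq_mul_of_isNilpotent_sub {R : Type*} [CommRing R] {e w : R}
    (he : IsIdempotentElem e) (h : IsNilpotent (e - e * w)) : ∃ t, e = w * t := by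
  obtain ⟨N, hN⟩ := h
  have h1 : e * (1 - w) ^ (N + 1) = 0 := by
    rw [← he.pow_succ_eq N, ← mul_pow, mul_one_sub, pow_succ, hN, zero_mul]
  obtain ⟨s, hs⟩ : 1 - (1 - w) ∣ 1 - (1 - w) ^ (N + 1) := one_sub_dvd_one_sub_pow _ _
  refine ⟨s * e, ?_⟩
  calc e = e * (1 - (1 - w) ^ (N + 1)) := by rw [mul_sub, mul_one, h1, sub_zero]
    _ = w * (s * e) := by rw [hs]; ring

theorem IsSylowIn.exists_conj_le [Finite G] {ℓ : ℕ} (hℓ : ℓ.Prime) {D H P : Subgroup G}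
    (hD : IsSylowIn ℓ D H) (hP : IsPGroup ℓ P) (hPH : P ≤ H) :
    ∃ g ∈ H, ∀ p ∈ P, g⁻¹ * p * g ∈ D := by
  have : Fact ℓ.Prime := ⟨hℓ⟩
  obtain ⟨T, rfl⟩ := hD
  obtain ⟨Q, hQ⟩ := (hP.comap_subtype (K := H)).exists_le_sylow
  obtain ⟨g, hg⟩ := MulAction.exists_smul_eq H T Q
  refine ⟨g, g.2, fun p hp => ?_⟩
  have h1 : (⟨p, hPH hp⟩ : H) ∈ Q := hQ hp
  rw [← hg] at h1
  have h2 := (Subgroup.mem_pointwise_smul_iff_inv_smul_mem (a := MulAut.conj g)).1 h1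
  exact ⟨_, h2, by simp⟩

variable (𝔪 : Ideal AlgInt) [𝔪.IsMaximal]

/-- If the block idempotent has a nonzero coefficient at `m`, then every `ℓ`-subgroup
centralizing `m` is conjugate to a subgroup of the defect group. The class sum of a defect class
is invertible modulo nilpotent elements in the summand cut out by the idempotent `e`, hence `e` is
a multiple of this class sum. -/
theorem exists_conj_le_of_coeff_ne_zero [Finite G] {ℓ : ℕ} (hℓ : ℓ.Prime)
    (h𝔪 : (ℓ : AlgInt) ∈ 𝔪) {χ : G → ℂ} {D : Subgroup G}
    {e : MonoidAlgebra (AlgInt ⧸ 𝔪) G} (he : IsBlockIdempotent 𝔪 (bl 𝔪 χ) e) {x : G}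
    (hx : lam 𝔪 χ (ConjClasses.mk x) ≠ 0)
    (hD : IsSylowIn ℓ D (Subgroup.centralizer {x})) {m : G} (hm : e.coeff m ≠ 0)
    {P : Subgroup G} (hP : IsPGroup ℓ P) (hPm : ∀ p ∈ P, p * m = m * p) :
    ∃ g, ∀ p ∈ P, g⁻¹ * p * g ∈ D := by
  classical
  have : Fintype G := Fintype.ofFinite G
  let _ : Field (AlgInt ⧸ 𝔪) := Ideal.Quotient.field 𝔪
  obtain ⟨hec, hei, hel⟩ := he
  set c := lam 𝔪 χ (ConjClasses.mk x) with hc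
  let w : MonoidAlgebra (AlgInt ⧸ 𝔪) G :=
    MonoidAlgebra.ofCoeff (Finsupp.equivFunOnFinite.symm fun g =>
      if ConjClasses.mk g = ConjClasses.mk x then c⁻¹ else 0)
  have hwc : w ∈ Subalgebra.center (AlgInt ⧸ 𝔪) (MonoidAlgebra (AlgInt ⧸ 𝔪) G) := by
    rw [mem_center_iff_coeff]
    intro g h
    have : ConjClasses.mk (h * g * h⁻¹) = ConjClasses.mk g := by
      rw [ConjClasses.mk_eq_mk_iff_isConj, isConj_comm]
      exact isConj_iff.2 ⟨h, rfl⟩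
    simp [w, this]
  have hw : ∀ ψ : G → ℂ, lamLin 𝔪 ψ w = c⁻¹ * lam 𝔪 ψ (ConjClasses.mk x) := by
    intro ψ
    unfold lamLin
    rw [finsum_eq_single _ (ConjClasses.mk x)]
    · simp only [w, Finsupp.coe_equivFunOnFinite_symm]
      rw [if_pos (mk_out _)]
    · intro K hK
      simp only [w, Finsupp.coe_equivFunOnFinite_symm]
      rw [mk_out, if_neg hK, zero_mul]
  have hnil : IsNilpotent (e - e * w) := by
    refine isNilpotent_of_lamLin_eq_zero 𝔪 (sub_mem hec (mul_mem hec hwc)) fun ψ hψ => ?_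
    rw [lamLin_sub, lamLin_mul 𝔪 hψ hec hwc, hel ψ hψ, hw]
    split_ifs with hb
    · rw [hb.2, ← hc, inv_mul_cancel₀ hx]; simp
    · simp
  obtain ⟨t, ht, het⟩ : ∃ t ∈ Subalgebra.center (AlgInt ⧸ 𝔪) (MonoidAlgebra (AlgInt ⧸ 𝔪) G),
      e = w * t := by
    let C := Subalgebra.center (AlgInt ⧸ 𝔪) (MonoidAlgebra (AlgInt ⧸ 𝔪) G)
    obtain ⟨t, ht⟩ := exists_eq_mul_of_isNilpotent_sub (R := C) (e := ⟨e, hec⟩) (w := ⟨w, hwc⟩)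
      (Subtype.ext hei) (by
        obtain ⟨N, hN⟩ := hnil
        exact ⟨N, Subtype.ext hN⟩)
    exact ⟨t, t.2, congrArg Subtype.val ht⟩
  have hcoeff : e.coeff m = ∑ g, w.coeff g * t.coeff (g⁻¹ * m) := by
    rw [het, MonoidAlgebra.coeff_mul, Finsupp.sum_fintype _ _ (by simp)]
    refine Finset.sum_congr rfl fun g _ => ?_
    rw [Finsupp.sum_fintype _ _ (by simp), Finset.sum_eq_single (g⁻¹ * m)]
    · simp
    · intro b _ hb
      rw [if_neg]
      rintro rfl
      simp at hb
    · simp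
  rw [hcoeff] at hm
  obtain ⟨y, hy, hyP⟩ := exists_commute_of_sum_ne_zero hℓ
    ((natCast_residue_eq_zero_iff 𝔪 hℓ h𝔪 ℓ).2 dvd_rfl) hP _ (fun p hp g => by
      have h1 := mem_center_iff_coeff.1 hwc g p
      have h2 := mem_center_iff_coeff.1 ht (g⁻¹ * m) p
      have h3 : (p * g * p⁻¹)⁻¹ * m = p * (g⁻¹ * m) * p⁻¹ := by
        have : p⁻¹ * m = m * p⁻¹ := by
          rw [inv_mul_eq_iff_eq_mul, ← mul_assoc, hPm p hp, mul_inv_cancel_right]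
        simp only [mul_inv_rev, inv_inv, mul_assoc, this]
      rw [h1, h3, h2]) hm
  have hyx : ConjClasses.mk y = ConjClasses.mk x := by
    by_contra hne
    apply hy
    simp [w, hne]
  obtain ⟨k, hk⟩ := isConj_iff.1 (ConjClasses.mk_eq_mk_iff_isConj.1 hyx)
  have hPk : IsPGroup ℓ (P.map (MulAut.conj k).toMonoidHom) := hP.map _
  obtain ⟨g, -, hg⟩ := hD.exists_conj_le hℓ hPk (by
    rintro _ ⟨p, hp, rfl⟩
    rw [Subgroup.mem_centralizer_singleton_iff, ← hk]
    have := hyP p hp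
    simp [mul_assoc]
    rw [← mul_assoc p, this, mul_assoc])
  refine ⟨k⁻¹ * g, fun p hp => ?_⟩
  have := hg _ (Subgroup.mem_map_of_mem _ hp)
  simpa [mul_assoc] using this

/-- Let `M` act on a module of `W` through `j : M → W` with a character in a block with defect
group `D`. If the trace of an element `y` of `W` is nonzero modulo `𝔪`, then every `ℓ`-subgroup
of `M` whose image centralizes `y` is conjugate to a subgroup of `D`. -/
theorem exists_conj_le_of_red_character_ne_zero {M : Type u} {W : Type v} [Group M] [Finite M]
    [Group W] [Finite W] {ℓ : ℕ} (hℓ : ℓ.Prime) (h𝔪 : (ℓ : AlgInt) ∈ 𝔪) (j : M →* W) {n : ℕ}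
    (ρ : Representation ℂ W (Fin n → ℂ)) {χ : M → ℂ} (hχ : χ ∈ Irr M)
    (hρχ : ∀ m, ρ.character (j m) = χ m) {D : Subgroup M}
    (hD : IsDefectGroup 𝔪 ℓ (bl 𝔪 χ) D) {y : W} (hy : red 𝔪 (ρ.character y) ≠ 0)
    {R : Subgroup M} (hR : IsPGroup ℓ R) (hRy : ∀ r ∈ R, j r * y = y * j r) :
    ∃ g, ∀ r ∈ R, g⁻¹ * r * g ∈ D := by
  classical
  have : Fintype M := Fintype.ofFinite M
  obtain ⟨-, e, he, x, -, hx, hDx⟩ := hD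
  have hχb : χ ∈ bl 𝔪 χ := ⟨hχ, rfl⟩
  obtain ⟨e', he'c, he'⟩ := exists_center_lift 𝔪 he.1
  let σ : Representation ℂ M (Fin n → ℂ) := ρ.comp j
  have hσ : σ.character = χ := funext hρχ
  obtain ⟨c, hc, hc'⟩ := exists_scalar_lamLin 𝔪 (ρ := σ) (hσ ▸ hχ) he'c
  rw [hσ, he', he.2.2 χ hχ, if_pos hχb] at hc'
  -- the trace of `y` times the idempotent
  have htr : ∑ m, ((e'.coeff m : AlgInt) : ℂ) * ρ.character (y * j m) =
      (c : ℂ) * ρ.character y := by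
    have h1 : LinearMap.trace ℂ (Fin n → ℂ) (ρ y * intAlgHom σ e') = (c : ℂ) * ρ.character y := by
      rw [hc, mul_smul_comm, mul_one, map_smul, smul_eq_mul]
      rfl
    rw [← h1, intAlgHom_apply, Finset.mul_sum, map_sum]
    refine Finset.sum_congr rfl fun m _ => ?_
    rw [mul_smul_comm, map_smul, smul_eq_mul]
    congr 1
    unfold Representation.character
    rw [map_mul]
    rfl
  have hint : ∀ w, IsIntegral ℤ (ρ.character w) := isIntegral_character ρ
  have hsum : ∑ m, e.coeff m * red 𝔪 (ρ.character (y * j m)) ≠ 0 := by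
    have h1 : ∑ m, e'.coeff m * (⟨_, hint (y * j m)⟩ : AlgInt) = c * ⟨_, hint y⟩ := by
      apply Subtype.ext
      simpa using htr
    have h2 := congrArg (Ideal.Quotient.mk 𝔪) h1
    rw [map_sum, map_mul, hc', one_mul, ← red_eq_mk] at h2
    rw [← h2] at hy
    convert hy using 2 with m
    rw [map_mul, ← he', MonoidAlgebra.coeff_mapRingHom, ← red_eq_mk]
  obtain ⟨m, hm, hmR⟩ := exists_commute_of_sum_ne_zero hℓ
    ((natCast_residue_eq_zero_iff 𝔪 hℓ h𝔪 ℓ).2 dvd_rfl) hR _ (fun r hr m => by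
      have h1 : y * j (r * m * r⁻¹) = j r * (y * j m) * (j r)⁻¹ := by
        rw [map_mul, map_mul, map_inv, ← mul_assoc, ← mul_assoc, ← mul_assoc, hRy r hr]
      rw [mem_center_iff_coeff.1 he.1, h1, Representation.char_conj]) hsum
  exact exists_conj_le_of_coeff_ne_zero 𝔪 hℓ h𝔪 he (hx χ hχb) hDx (left_ne_zero_of_mul hm) hR hmR

end DefectGroups

/-! ### Prime parts of elements and radical subgroups -/

section PrimeParts

variable {G : Type u} [Group G] {H : Type v} [Group H]

/-- The power `a ^ e` is the part of `a` of order dividing `r`: `e ≡ 1` modulo `r` and `e ≡ 0`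
modulo `s`. -/
theorem exists_pow_map_eq_of_coprime (f : G →* H) (a : G) {r s : ℕ} (hrs : r.Coprime s)
    (h : orderOf a = r * s) (hf : orderOf (f a) ∣ r) :
    ∃ e : ℕ, f (a ^ e) = f a ∧ (a ^ e) ^ r = 1 := by
  obtain ⟨e, he1, he2⟩ := Nat.chineseRemainder hrs 1 0
  refine ⟨e, ?_, ?_⟩
  · rw [map_pow]
    conv_rhs => rw [← pow_one (f a)]
    exact pow_eq_pow_iff_modEq.2 (he1.of_dvd hf)
  · rw [← pow_mul, ← orderOf_dvd_iff_pow_eq_one, h, mul_comm]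
    exact mul_dvd_mul_right ((Nat.modEq_zero_iff_dvd).1 he2) r

/-- The image of an element is the image of its `ℓ`-part if it has `ℓ`-power order. -/
theorem exists_pow_map_eq_of_pow_eq_one [Finite G] {ℓ : ℕ} (hℓ : ℓ.Prime) (f : G →* H) {a : G}
    {k : ℕ}
    (hf : f a ^ ℓ ^ k = 1) : ∃ e : ℕ, f (a ^ e) = f a ∧ ∃ j, (a ^ e) ^ ℓ ^ j = 1 := by
  have ho := (orderOf_pos a).ne'
  obtain ⟨e, he, he'⟩ := exists_pow_map_eq_of_coprime f a
    (r := ordProj[ℓ] (orderOf a)) (s := ordCompl[ℓ] (orderOf a))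
    ((Nat.coprime_ordCompl hℓ ho).pow_left _) (Nat.ordProj_mul_ordCompl_eq_self _ _).symm (by
      obtain ⟨i, -, hi⟩ := (Nat.dvd_prime_pow hℓ).1 (orderOf_dvd_of_pow_eq_one hf)
      have h1 : orderOf (f a) ∣ orderOf a := orderOf_map_dvd f a
      rw [hi] at h1 ⊢
      exact pow_dvd_pow _ ((hℓ.pow_dvd_iff_le_factorization ho).1 h1))
  exact ⟨e, he, _, he'⟩

/-- The image of an element is the image of its `ℓ'`-part if it has order prime to `ℓ`. -/
theorem exists_pow_map_eq_of_coprime_orderOf [Finite G] {ℓ : ℕ} (hℓ : ℓ.Prime) (f : G →* H)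
    {a : G}
    (hf : (orderOf (f a)).Coprime ℓ) :
    ∃ e : ℕ, f (a ^ e) = f a ∧ (orderOf (a ^ e)).Coprime ℓ := by
  have ho := (orderOf_pos a).ne'
  obtain ⟨e, he, he'⟩ := exists_pow_map_eq_of_coprime f a
    (r := ordCompl[ℓ] (orderOf a)) (s := ordProj[ℓ] (orderOf a))
    ((Nat.coprime_ordCompl hℓ ho).symm.pow_right _)
    (by rw [mul_comm]; exact (Nat.ordProj_mul_ordCompl_eq_self _ _).symm) (by
      have h1 : orderOf (f a) ∣ orderOf a := orderOf_map_dvd f a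
      rw [← Nat.ordProj_mul_ordCompl_eq_self (orderOf a) ℓ] at h1
      exact (hf.pow_right _).dvd_of_dvd_mul_left h1)
  exact ⟨e, he, (Nat.coprime_ordCompl hℓ ho).symm.coprime_dvd_left (orderOf_dvd_of_pow_eq_one he')⟩

theorem mem_normalizer_of_conj_mem [Finite G] {D : Subgroup G} {n : G}
    (h : ∀ d ∈ D, n * d * n⁻¹ ∈ D) :
    n ∈ Subgroup.normalizer (D : Set G) := by
  rw [Subgroup.mem_normalizer_iff_map_conj_eq]
  refine Subgroup.eq_of_le_of_card_ge ?_ ?_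
  · rintro _ ⟨d, hd, rfl⟩
    exact h d hd
  · exact (Nat.card_congr (D.equivMapOfInjective _ (MulAut.conj n).injective).toEquiv).le

end PrimeParts

section Radical

variable {G : Type u} [Group G] {ℓ : ℕ} {D : Subgroup G}

/-- A radical `ℓ`-subgroup contains the `ℓ`-subgroups that its normalizer normalizes. -/
theorem IsRadical.le_of_normal (hD : IsRadical ℓ D) {P : Subgroup G} (hP : IsPGroup ℓ P)
    (hPN : P ≤ Subgroup.normalizer (D : Set G))
    (hn : ∀ n ∈ Subgroup.normalizer (D : Set G), ∀ p ∈ P, n * p * n⁻¹ ∈ P) : P ≤ D := by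
  rw [hD.2]
  intro p hp
  have h1 : (P.subgroupOf (Subgroup.normalizer (D : Set G))).Normal :=
    ⟨fun p hp n => hn n n.2 p hp⟩
  have h2 : P.subgroupOf (Subgroup.normalizer (D : Set G)) ≤
      opCore ℓ (Subgroup.normalizer (D : Set G)) := le_sSup ⟨h1, hP.comap_subtype⟩
  exact ⟨⟨p, hPN hp⟩, h2 hp, rfl⟩

theorem isPGroup_zpowers {ℓ k : ℕ} {z : G} (h : z ^ ℓ ^ k = 1) :
    IsPGroup ℓ (Subgroup.zpowers z) := by
  rintro ⟨_, m, rfl⟩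
  refine ⟨k, Subtype.ext ?_⟩
  simp only [Subgroup.coe_pow, Subgroup.coe_one]
  rw [← zpow_natCast, ← zpow_mul, mul_comm, zpow_mul, zpow_natCast, h, one_zpow]

theorem IsRadical.mem_of_mem_center (hD : IsRadical ℓ D) {z : G} (hz : z ∈ Subgroup.center G)
    {k : ℕ} (hk : z ^ ℓ ^ k = 1) : z ∈ D := by
  have hle : Subgroup.zpowers z ≤ Subgroup.center G := by simpa using hz
  refine hD.le_of_normal (isPGroup_zpowers hk) (hle.trans (Subgroup.center_le_normalizer _))
    (fun n _ p hp => ?_) (Subgroup.mem_zpowers z)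
  rwa [Subgroup.mem_center_iff.1 (hle hp) n, mul_inv_cancel_right]

/-- A radical `ℓ`-subgroup `D` consists of the elements of `ℓ`-power order of `D Z(G)`. -/
theorem IsRadical.mul_mem_of_pow_eq_one (hD : IsRadical ℓ D) {d z : G} (hd : d ∈ D)
    (hz : z ∈ Subgroup.center G) {k : ℕ} (hk : (d * z) ^ ℓ ^ k = 1) : d * z ∈ D := by
  obtain ⟨j, hj⟩ := hD.1 ⟨d, hd⟩
  have hj' : d ^ ℓ ^ j = 1 := congrArg Subtype.val hj
  refine mul_mem hd (hD.mem_of_mem_center hz (k := k + j) ?_)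
  have hc : Commute d z := Subgroup.mem_center_iff.1 hz d
  have h1 : (d * z) ^ ℓ ^ (k + j) = 1 := by rw [pow_add, pow_mul, hk, one_pow]
  rwa [hc.mul_pow, pow_add ℓ k j, mul_comm (ℓ ^ k), pow_mul d, hj', one_pow, one_mul,
    mul_comm (ℓ ^ j), ← pow_add] at h1

variable {S : Type v} [Group S]

theorem IsRadical.exists_pow_eq_one (hD : IsRadical ℓ D) {d : G} (hd : d ∈ D) :
    ∃ k, d ^ ℓ ^ k = 1 := by
  obtain ⟨j, hj⟩ := hD.1 ⟨d, hd⟩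
  exact ⟨j, congrArg Subtype.val hj⟩

theorem IsRadical.mem_of_map_mem (hD : IsRadical ℓ D) {π : G →* S}
    (hπ : π.ker ≤ Subgroup.center G) {g : G} (hg : π g ∈ D.map π) {k : ℕ} (hk : g ^ ℓ ^ k = 1) :
    g ∈ D := by
  obtain ⟨d, hd, hdg⟩ := hg
  have h1 : d⁻¹ * g ∈ π.ker := by rw [MonoidHom.mem_ker, map_mul, map_inv, hdg, inv_mul_cancel]
  have := hD.mul_mem_of_pow_eq_one hd (hπ h1) (k := k) (by rwa [mul_inv_cancel_left])
  rwa [mul_inv_cancel_left] at this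

theorem IsRadical.mem_normalizer_of_map_mem [Finite G] (hD : IsRadical ℓ D) {π : G →* S}
    (hπ : π.ker ≤ Subgroup.center G) {g : G}
    (hg : π g ∈ Subgroup.normalizer (D.map π : Set S)) :
    g ∈ Subgroup.normalizer (D : Set G) := by
  refine mem_normalizer_of_conj_mem fun d hd => ?_
  obtain ⟨k, hk⟩ := hD.exists_pow_eq_one hd
  refine hD.mem_of_map_mem hπ (k := k) ?_ (by rw [conj_pow, hk]; simp)
  rw [map_mul, map_mul, map_inv]
  exact (Subgroup.mem_normalizer_iff.1 hg _).1 (Subgroup.mem_map_of_mem π hd)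

/-- The image of a radical `ℓ`-subgroup in a central quotient is radical. -/
theorem IsRadical.map [Finite G] (hℓ : ℓ.Prime) (hD : IsRadical ℓ D) {π : G →* S}
    (hπs : Function.Surjective π) (hπ : π.ker ≤ Subgroup.center G) : IsRadical ℓ (D.map π) := by
  have : Fact ℓ.Prime := ⟨hℓ⟩
  have hQ : IsPGroup ℓ (D.map π) := hD.1.map π
  refine ⟨hQ, le_antisymm ?_ ?_⟩
  · intro q hq
    have h1 : ((D.map π).subgroupOf (Subgroup.normalizer (D.map π : Set S))).Normal :=
      Subgroup.normal_in_normalizer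
    have h2 : (D.map π).subgroupOf (Subgroup.normalizer (D.map π : Set S)) ≤
        opCore ℓ (Subgroup.normalizer (D.map π : Set S)) := le_sSup ⟨h1, hQ.comap_subtype⟩
    exact ⟨⟨q, Subgroup.le_normalizer hq⟩, h2 hq, rfl⟩
  · rw [Subgroup.map_le_iff_le_comap]
    refine sSup_le ?_
    rintro N ⟨hNn, hNp⟩ ⟨n, hnn⟩ hn
    let N' : Subgroup S := N.map (Subgroup.subtype _)
    let W : Subgroup G := N'.comap π
    have hN'p : IsPGroup ℓ N' := hNp.map _
    have hN'n : ∀ s ∈ Subgroup.normalizer (D.map π : Set S), ∀ x ∈ N', s * x * s⁻¹ ∈ N' := by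
      rintro s hs _ ⟨x, hx, rfl⟩
      exact ⟨_, hNn.conj_mem x hx ⟨s, hs⟩, rfl⟩
    -- `W` is a central extension of an `ℓ`-group, so its elements of `ℓ`-power order form a
    -- subgroup, which is normalized by the normalizer of `D`
    have : Finite S := Finite.of_surjective π hπs
    have hnil : Group.IsNilpotent N' := hN'p.isNilpotent
    let f : W →* N' := (π.comp W.subtype).codRestrict N' fun w => w.2
    have hWn : Group.IsNilpotent W := by
      refine Subgroup.isNilpotent_of_ker_le_center f fun w hw => ?_
      have h1 : (w : G) ∈ Subgroup.center G := hπ (congrArg Subtype.val hw)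
      rw [Subgroup.mem_center_iff]
      exact fun g => Subtype.ext (Subgroup.mem_center_iff.1 h1 g)
    let T : Sylow ℓ W := default
    have hT : (T : Subgroup W).Normal := inferInstance
    have hmemT : ∀ w : W, ∀ k, (w : G) ^ ℓ ^ k = 1 → w ∈ (T : Subgroup W) := by
      intro w k hk
      obtain ⟨T', hT'⟩ := (isPGroup_zpowers (z := w) (Subtype.ext hk)).exists_le_sylow
      obtain ⟨g, hg⟩ := MulAction.exists_smul_eq W T T'
      rw [Sylow.smul_eq_of_normal] at hg
      rw [hg]
      exact hT' (Subgroup.mem_zpowers w)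
    have hTD : (T : Subgroup W).map W.subtype ≤ D := by
      refine hD.le_of_normal (T.2.map _) ?_ ?_
      · rintro _ ⟨w, hw, rfl⟩
        obtain ⟨⟨x, hxn⟩, hx, hxw⟩ := w.2
        refine hD.mem_normalizer_of_map_mem hπ ?_
        rw [Subgroup.subtype_apply, ← hxw]
        exact hxn
      · rintro m hm _ ⟨w, hw, rfl⟩
        obtain ⟨k, hk⟩ := T.2 ⟨w, hw⟩
        have hk' : (w : G) ^ ℓ ^ k = 1 := by
          simpa using congrArg (fun x : (T : Subgroup W) => ((x : W) : G)) hk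
        have hmW : m * w * m⁻¹ ∈ W := by
          change π (m * w * m⁻¹) ∈ N'
          rw [map_mul, map_mul, map_inv]
          exact hN'n _ (Subgroup.le_normalizer_map π ⟨m, hm, rfl⟩) _ w.2
        exact ⟨⟨_, hmW⟩, hmemT _ k (by simp [conj_pow, hk']), rfl⟩
    obtain ⟨g, rfl⟩ := hπs n
    obtain ⟨k, hk⟩ := hNp ⟨_, hn⟩
    have hk' : π g ^ ℓ ^ k = 1 := congrArg Subtype.val (congrArg Subtype.val hk)
    obtain ⟨e, he, j, hj⟩ := exists_pow_map_eq_of_pow_eq_one hℓ π hk'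
    have hgW : g ^ e ∈ W := by
      change π (g ^ e) ∈ N'
      rw [he]
      exact ⟨_, hn, rfl⟩
    refine ⟨g ^ e, hTD ⟨⟨_, hgW⟩, hmemT _ j hj, rfl⟩, he⟩

end Radical

/-! ### The universal covering group -/

section UniversalCover

variable {G S : Type u} [Group G] [Group S] {π : G →* S}

open scoped commutatorElement in
theorem commutatorElement_mul_of_mem_center {E : Type v} [Group E] {y z : E}
    (hy : y ∈ Subgroup.center E) (hz : z ∈ Subgroup.center E) (a b : E) :
    ⁅y * a, z * b⁆ = ⁅a, b⁆ := by
  have hy' := Subgroup.mem_center_iff.1 hy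
  have hz' := Subgroup.mem_center_iff.1 hz
  calc ⁅y * a, z * b⁆ = y * (a * z) * b * a⁻¹ * y⁻¹ * b⁻¹ * z⁻¹ := by
        rw [commutatorElement_def]; group
    _ = y * (z * a * b * a⁻¹) * y⁻¹ * b⁻¹ * z⁻¹ := by rw [hz']; group
    _ = z * (a * b * a⁻¹ * b⁻¹) * z⁻¹ := by rw [← hy']; group
    _ = ⁅a, b⁆ := by rw [← hz', mul_inv_cancel_right, commutatorElement_def]

open scoped commutatorElement in
/-- Homomorphisms on a perfect group which agree modulo the centre of the target are equal,
because a commutator depends only on the classes of its entries modulo the centre. -/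
theorem eq_of_mul_inv_mem_center (hG : commutator G = ⊤) {E : Type v} [Group E] {f f' : G →* E}
    (h : ∀ g, f g * (f' g)⁻¹ ∈ Subgroup.center E) : f = f' := by
  have h1 : commutator G ≤ f.eqLocus f' := by
    rw [commutator_def, Subgroup.commutator_le]
    intro a _ b _
    have ha : f a = f a * (f' a)⁻¹ * f' a := by group
    have hb : f b = f b * (f' b)⁻¹ * f' b := by group
    change f ⁅a, b⁆ = f' ⁅a, b⁆
    rw [map_commutatorElement, map_commutatorElement, ha, hb,
      commutatorElement_mul_of_mem_center (h a) (h b)]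
  ext g
  exact h1 (hG ▸ Subgroup.mem_top g)

/-- A universal covering group is perfect: otherwise `g ↦ (g, 1)` and `g ↦ (g, g G')` would be
different lifts to the central extension `G × G/G'`. -/
theorem IsUniversalCover.commutator_eq_top (hπ : IsUniversalCover π) : commutator G = ⊤ := by
  obtain ⟨⟨hs, hk⟩, hu⟩ := hπ
  obtain ⟨h, -, huniq⟩ := hu (G × Abelianization G) (π.comp (MonoidHom.fst _ _)) ⟨fun s => by
      obtain ⟨g, rfl⟩ := hs s
      exact ⟨(g, 1), rfl⟩, fun x hx => by
      rw [Subgroup.mem_center_iff]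
      intro y
      have h1 := Subgroup.mem_center_iff.1 (hk (show x.1 ∈ π.ker from hx)) y.1
      exact Prod.ext h1 (mul_comm _ _)⟩
  have h1 := huniq ((MonoidHom.id G).prod 1) (by ext; rfl)
  have h2 := huniq ((MonoidHom.id G).prod Abelianization.of) (by ext; rfl)
  rw [← Abelianization.ker_of G]
  refine eq_top_iff.2 fun g _ => ?_
  have := congrArg Prod.snd (DFunLike.congr_fun (h2.trans h1.symm) g)
  exact this

open scoped commutatorElement in
/-- A universal covering group of a finite group is finite: it has only finitely many
commutators, hence a finite derived subgroup by Schur's theorem, and it is perfect. -/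
theorem IsUniversalCover.finite [Finite S] (hπ : IsUniversalCover π) : Finite G := by
  have hs : Function.Surjective π := hπ.1.1
  have hfin : (commutatorSet G).Finite := by
    refine (Set.finite_range fun p : S × S =>
      ⁅Function.surjInv hs p.1, Function.surjInv hs p.2⁆).subset ?_
    rintro _ ⟨a, b, rfl⟩
    refine ⟨(π a, π b), ?_⟩
    have key : ∀ g, Function.surjInv hs (π g) * g⁻¹ ∈ Subgroup.center G := fun g => hπ.1.2 (by
      rw [MonoidHom.mem_ker, map_mul, Function.surjInv_eq hs, map_inv, mul_inv_cancel])
    have h1 := commutatorElement_mul_of_mem_center (key a) (key b) a b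
    rwa [inv_mul_cancel_right, inv_mul_cancel_right] at h1
  have : Finite (commutatorSet G) := hfin
  have h1 : Finite (commutator G) := inferInstance
  rw [hπ.commutator_eq_top] at h1
  exact Finite.of_equiv _ Subgroup.topEquiv.toEquiv

theorem center_eq_bot [IsSimpleGroup S] (hS : ∃ a b : S, a * b ≠ b * a) :
    Subgroup.center S = ⊥ := by
  refine (IsSimpleGroup.eq_bot_or_eq_top_of_normal (Subgroup.center S) inferInstance).resolve_right
    fun h => ?_
  obtain ⟨a, b, hab⟩ := hS
  exact hab (Subgroup.mem_center_iff.1 (h ▸ Subgroup.mem_top b) a)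

theorem IsUniversalCover.ker_eq_center [IsSimpleGroup S] (hS : ∃ a b : S, a * b ≠ b * a)
    (hπ : IsUniversalCover π) : π.ker = Subgroup.center G := by
  refine le_antisymm hπ.1.2 fun z hz => ?_
  have h2 : π z ∈ Subgroup.center S := by
    rw [Subgroup.mem_center_iff]
    intro s
    obtain ⟨g, rfl⟩ := hπ.1.1 s
    rw [← map_mul, ← map_mul, Subgroup.mem_center_iff.1 hz]
  rwa [center_eq_bot hS] at h2

end UniversalCover

/-! ### Lifting conjugation to the universal covering group -/

section LiftedAction

variable {G S : Type u} [Group G] [Group S] {π : G →* S} {A : Type u} [Group A] {ι : G →* A}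

/-- An endomorphism of a perfect group is determined by its effect on a central quotient. -/
theorem eq_of_map_eq (hG : commutator G = ⊤) (hι : ι.ker ≤ Subgroup.center G) {f f' : G →* G}
    (h : ∀ g, ι (f g) = ι (f' g)) : f = f' :=
  eq_of_mul_inv_mem_center hG fun g => hι (by
    rw [MonoidHom.mem_ker, map_mul, map_inv, h, mul_inv_cancel])

/-- Conjugation by an element of `A` on the central quotient `ι(G)` lifts to the universal
covering group: apply the universal property to the pullback of `ι` along `a ι(·) a⁻¹`. -/
theorem IsUniversalCover.exists_lift_conj (hπ : IsUniversalCover π)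
    (hker : π.ker = Subgroup.center G) (hZS : Subgroup.center S = ⊥)
    (hι : ι.ker ≤ Subgroup.center G) (hn : ι.range.Normal) (a : A) :
    ∃ f : G →* G, ∀ g, ι (f g) = a * ι g * a⁻¹ := by
  let E : Subgroup (G × G) :=
    { carrier := {p | ι p.2 = a * ι p.1 * a⁻¹}
      mul_mem' := fun {p q} hp hq => by
        simp only [Set.mem_ofPred_eq] at hp hq ⊢
        simp [hp, hq, mul_assoc]
      one_mem' := by simp
      inv_mem' := fun {p} hp => by
        simp only [Set.mem_ofPred_eq] at hp ⊢
        simp [hp, mul_assoc] }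
  let p₁ : E →* G := (MonoidHom.fst G G).comp E.subtype
  let p₂ : E →* G := (MonoidHom.snd G G).comp E.subtype
  have hp₁ : Function.Surjective p₁ := fun g => by
    obtain ⟨g', hg'⟩ := hn.conj_mem (ι g) ⟨g, rfl⟩ a
    exact ⟨⟨(g, g'), hg'⟩, rfl⟩
  have hcent : IsCentralExtension (π.comp p₁) := by
    refine ⟨hπ.1.1.comp hp₁, fun x hx => ?_⟩
    have h1 : p₁ x ∈ Subgroup.center G := hker ▸ hx
    have hx2 : ι (p₂ x) = a * ι (p₁ x) * a⁻¹ := x.2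
    have h2 : p₂ x ∈ Subgroup.center G := by
      -- modulo `ker ι`, the second coordinate commutes with all of `G`
      rw [← hker, MonoidHom.mem_ker, ← Subgroup.mem_bot, ← hZS, Subgroup.mem_center_iff]
      intro s
      obtain ⟨g, rfl⟩ := hπ.1.1 s
      obtain ⟨g', hg'⟩ := hn.conj_mem (ι g) ⟨g, rfl⟩ a⁻¹
      have h3 : ι g = a * ι g' * a⁻¹ := by rw [hg']; group
      have h4 : (g * p₂ x) * (p₂ x * g)⁻¹ ∈ ι.ker := by
        have h5 : ι g' * ι (p₁ x) = ι (p₁ x) * ι g' := by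
          rw [← map_mul, ← map_mul, Subgroup.mem_center_iff.1 h1]
        rw [MonoidHom.mem_ker, map_mul, map_inv, mul_inv_eq_one, map_mul, map_mul, hx2, h3]
        calc a * ι g' * a⁻¹ * (a * ι (p₁ x) * a⁻¹) = a * (ι g' * ι (p₁ x)) * a⁻¹ := by group
          _ = _ := by rw [h5]; group
      have h6 : (g * p₂ x) * (p₂ x * g)⁻¹ ∈ π.ker := hker ▸ hι h4
      rw [MonoidHom.mem_ker, map_mul, map_inv, mul_inv_eq_one, map_mul, map_mul] at h6
      exact h6
    rw [Subgroup.mem_center_iff]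
    exact fun y => Subtype.ext (Prod.ext (Subgroup.mem_center_iff.1 h1 (p₁ y))
      (Subgroup.mem_center_iff.1 h2 (p₂ y)))
  obtain ⟨h, hh, -⟩ := hπ.2 E _ hcent
  have hid : p₁.comp h = MonoidHom.id G := by
    obtain ⟨k, -, hk⟩ := hπ.2 G π hπ.1
    exact (hk _ hh).trans (hk _ (MonoidHom.comp_id π)).symm
  refine ⟨p₂.comp h, fun g => ?_⟩
  have h1 : ι (p₂ (h g)) = a * ι (p₁ (h g)) * a⁻¹ := (h g).2
  have h2 : p₁ (h g) = g := DFunLike.congr_fun hid g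
  rwa [h2] at h1

/-- The action of `A` on the universal covering group `G` of `S` which lifts the conjugation action
on the central quotient `ι(G)`. -/
theorem IsUniversalCover.exists_autHom (hπ : IsUniversalCover π)
    (hker : π.ker = Subgroup.center G) (hZS : Subgroup.center S = ⊥)
    (hι : ι.ker ≤ Subgroup.center G) (hn : ι.range.Normal) :
    ∃ Φ : A →* MulAut G, (∀ a g, ι (Φ a g) = a * ι g * a⁻¹) ∧
      (∀ g, Φ (ι g) = MulAut.conj g) ∧
      ∀ a, Φ a = 1 ↔ a ∈ Subgroup.centralizer (ι.range : Set A) := by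
  have hG := hπ.commutator_eq_top
  choose f hf using hπ.exists_lift_conj hker hZS hι hn
  have hone : f 1 = MonoidHom.id G := eq_of_map_eq hG hι fun g => by simp [hf]
  have hmul : ∀ a b, f (a * b) = (f a).comp (f b) := fun a b =>
    eq_of_map_eq hG hι fun g => by simp [hf, mul_assoc]
  let Φ : A →* MulAut G := MonoidHom.mk'
    (fun a => MonoidHom.toMulEquiv (f a) (f a⁻¹) (by rw [← hmul, inv_mul_cancel, hone])
      (by rw [← hmul, mul_inv_cancel, hone])) fun a b => by
        ext g
        exact DFunLike.congr_fun (hmul a b) g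
  have hΦ : ∀ a g, ι (Φ a g) = a * ι g * a⁻¹ := hf
  refine ⟨Φ, hΦ, fun g => ?_, fun a => ?_⟩
  · ext h
    refine DFunLike.congr_fun (eq_of_map_eq hG hι (f := (Φ (ι g)).toMonoidHom)
      (f' := (MulAut.conj g).toMonoidHom) fun h => ?_) h
    change ι (Φ (ι g) h) = ι (g * h * g⁻¹)
    rw [hΦ, map_mul, map_mul, map_inv]
  · rw [Subgroup.mem_centralizer_iff]
    constructor
    · rintro ha _ ⟨g, rfl⟩
      have := hΦ a g
      rw [ha, MulAut.one_apply, eq_mul_inv_iff_mul_eq] at this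
      exact this
    · intro ha
      ext h
      refine DFunLike.congr_fun (eq_of_map_eq hG hι (f := (Φ a).toMonoidHom)
        (f' := MonoidHom.id G) fun g => ?_) h
      change ι (Φ a g) = ι g
      rw [hΦ, ← ha _ ⟨g, rfl⟩, mul_inv_cancel_right]

end LiftedAction

/-! ### Counting in finite groups -/

section Counting

variable {A : Type u} [Group A]

/-- If `J = N C_J(y)`, then the `J`-class of `y` is the `N`-orbit of `y`. -/
theorem ncard_carrier_mul_card [Finite A] {J N : Subgroup A} (hNJ : N ≤ J) (y : J)
    (h : ∀ g ∈ J, ∃ x ∈ N, x⁻¹ * g * y = y * (x⁻¹ * g)) :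
    (ConjClasses.mk y).carrier.ncard * Nat.card (N ⊓ Subgroup.centralizer {(y : A)} : Subgroup A) =
      Nat.card N := by
  let _ : MulAction N A := MulAction.compHom A (MulAut.conj.comp N.subtype)
  have hsmul : ∀ (x : N) (b : A), x • b = x * b * (x : A)⁻¹ := fun x b => rfl
  have h1 : Subtype.val '' (ConjClasses.mk y).carrier = MulAction.orbit N (y : A) := by
    ext b
    constructor
    · rintro ⟨z, hz, rfl⟩
      rw [ConjClasses.mem_carrier_iff_mk_eq, ConjClasses.mk_eq_mk_iff_isConj, isConj_comm,
        isConj_iff] at hz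
      obtain ⟨g, rfl⟩ := hz
      obtain ⟨x, hx, hxg⟩ := h g g.2
      refine ⟨⟨x, hx⟩, ?_⟩
      change x * y * x⁻¹ = g * y * (g : A)⁻¹
      calc x * y * x⁻¹ = x * (y * (x⁻¹ * g)) * (g : A)⁻¹ := by group
        _ = _ := by rw [← hxg]; group
    · rintro ⟨x, rfl⟩
      refine ⟨⟨x, hNJ x.2⟩ * y * ⟨x, hNJ x.2⟩⁻¹, ?_, rfl⟩
      rw [ConjClasses.mem_carrier_iff_mk_eq, ConjClasses.mk_eq_mk_iff_isConj, isConj_comm,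
        isConj_iff]
      exact ⟨_, rfl⟩
  have h2 : (MulAction.stabilizer N (y : A)).map N.subtype =
      N ⊓ Subgroup.centralizer {(y : A)} := by
    ext b
    rw [Subgroup.mem_inf, Subgroup.mem_centralizer_singleton_iff]
    constructor
    · rintro ⟨x, hx, rfl⟩
      exact ⟨x.2, (mul_inv_eq_iff_eq_mul.1 hx)⟩
    · rintro ⟨hb, hby⟩
      exact ⟨⟨b, hb⟩, mul_inv_eq_iff_eq_mul.2 hby, rfl⟩
  rw [← Set.ncard_image_of_injective _ Subtype.val_injective, h1, ← h2,
    Subgroup.card_map_of_injective N.subtype_injective, ← Nat.card_coe_set_eq]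
  rw [← Nat.card_prod]
  exact Nat.card_congr (MulAction.orbitProdStabilizerEquivGroup N (y : A))

theorem exists_conj_of_mk_eq {J N : Subgroup A} (y z : J)
    (h : ∀ g ∈ J, ∃ x ∈ N, x⁻¹ * g * y = y * (x⁻¹ * g))
    (hz : ConjClasses.mk z = ConjClasses.mk y) : ∃ x ∈ N, (z : A) = x * y * x⁻¹ := by
  rw [ConjClasses.mk_eq_mk_iff_isConj, isConj_comm, isConj_iff] at hz
  obtain ⟨g, rfl⟩ := hz
  obtain ⟨x, hx, hxg⟩ := h g g.2
  refine ⟨x, hx, ?_⟩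
  change g * y * (g : A)⁻¹ = x * y * x⁻¹
  calc g * y * (g : A)⁻¹ = x * (x⁻¹ * g * y) * (g : A)⁻¹ := by group
    _ = _ := by rw [hxg]; group

variable {ℓ : ℕ}

theorem ordProj_card_of_isPGroup [Finite A] (hℓ : ℓ.Prime) {P : Subgroup A} (hP : IsPGroup ℓ P) :
    ordProj[ℓ] (Nat.card P) = Nat.card P := by
  have : Fact ℓ.Prime := ⟨hℓ⟩
  obtain ⟨k, hk⟩ := IsPGroup.iff_card.1 hP
  rw [hk, hℓ.factorization_pow]
  simp

theorem IsSylowIn.card_eq [Finite A] (hℓ : ℓ.Prime) {P H : Subgroup A} (h : IsSylowIn ℓ P H) :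
    Nat.card P = ordProj[ℓ] (Nat.card H) := by
  have : Fact ℓ.Prime := ⟨hℓ⟩
  obtain ⟨T, rfl⟩ := h
  rw [Subgroup.card_map_of_injective H.subtype_injective]
  exact T.card_eq_multiplicity

theorem isSylowIn_of_maximal {P H : Subgroup A} (hPH : P ≤ H) (hP : IsPGroup ℓ P)
    (h : ∀ Q ≤ H, IsPGroup ℓ Q → P ≤ Q → Q ≤ P) : IsSylowIn ℓ P H := by
  obtain ⟨T, hT⟩ := (hP.comap_subtype (K := H)).exists_le_sylow
  have h1 : P ≤ (T : Subgroup H).map H.subtype := fun p hp => ⟨⟨p, hPH hp⟩, hT hp, rfl⟩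
  exact ⟨T, le_antisymm (h _ (Subgroup.map_subtype_le _) (T.2.map _) h1) h1⟩

/-- Both `A` and `X` have a number of Sylow subgroups congruent to `1`, and `P` has the same
normalizer in the two groups. -/
theorem index_modEq_one_of_normalizer_le [Finite A] (hℓ : ℓ.Prime) (P : Sylow ℓ A)
    {X : Subgroup A}
    (hX : Subgroup.normalizer ((P : Subgroup A) : Set A) ≤ X) : X.index ≡ 1 [MOD ℓ] := by
  have : Fact ℓ.Prime := ⟨hℓ⟩
  have hPX : (P : Subgroup A) ≤ X := Subgroup.le_normalizer.trans hX
  have h1 := card_sylow_modEq_one ℓ A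
  have h2 := card_sylow_modEq_one ℓ X
  rw [P.card_eq_index_normalizer] at h1
  rw [(P.subtype hPX).card_eq_index_normalizer] at h2
  have h3 : Subgroup.normalizer ((P.subtype hPX : Sylow ℓ X) : Set X) =
      (Subgroup.normalizer ((P : Subgroup A) : Set A)).subgroupOf X :=
    (Subgroup.subgroupOf_normalizer_eq hPX).symm
  rw [h3] at h2
  have h4 : _ = (Subgroup.normalizer (P : Set A)).index := Subgroup.relIndex_mul_index hX
  rw [← h4] at h1
  have h5 := h2.mul_right X.index
  rw [one_mul] at h5
  exact h5.symm.trans h1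

/-- The form of `index_modEq_one_of_normalizer_le` for subgroups `X ≤ H` of an ambient group. -/
theorem IsSylowIn.exists_card_eq_mul [Finite A] (hℓ : ℓ.Prime) {P H X : Subgroup A}
    (h : IsSylowIn ℓ P H)
    (hXH : X ≤ H) (hX : Subgroup.normalizer (P : Set A) ⊓ H ≤ X) :
    ∃ k, Nat.card H = k * Nat.card X ∧ k ≡ 1 [MOD ℓ] := by
  obtain ⟨T, rfl⟩ := h
  refine ⟨(X.subgroupOf H).index, ?_, index_modEq_one_of_normalizer_le hℓ T ?_⟩
  · rw [mul_comm, ← Subgroup.card_mul_index (X.subgroupOf H)]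
    rw [Nat.card_congr (Subgroup.subgroupOfEquivOfLe hXH).toEquiv]
  · intro x hx
    refine hX ⟨?_, x.2⟩
    exact Subgroup.le_normalizer_map H.subtype ⟨x, hx, rfl⟩

/-- If `D` contains the elements of `ℓ`-power order of the kernel of `f`, then the index of `D` and
the index of `f(D)` in `f(A)` have the same `ℓ`-part. -/
theorem ordProj_index_mul_card_map [Finite A] (hℓ : ℓ.Prime) {B : Type v} [Group B] (f : A →* B)
    {D : Subgroup A} (hD : IsPGroup ℓ D) (hZ : ∀ z ∈ f.ker, ∀ k, z ^ ℓ ^ k = 1 → z ∈ D) :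
    ordProj[ℓ] D.index * Nat.card (D.map f) = ordProj[ℓ] (Nat.card f.range) := by
  have : Fact ℓ.Prime := ⟨hℓ⟩
  have : Finite f.range := Finite.of_surjective _ f.rangeRestrict_surjective
  have : Finite (D.map f) := Finite.of_surjective _ (f.subgroupMap_surjective D)
  have h1 : Nat.card (D ⊓ f.ker : Subgroup A) = ordProj[ℓ] (Nat.card f.ker) := by
    refine IsSylowIn.card_eq hℓ (isSylowIn_of_maximal inf_le_right (hD.to_le inf_le_left)
      fun Q hQ hQp _ q hq => ⟨?_, hQ hq⟩)
    obtain ⟨k, hk⟩ := hQp ⟨q, hq⟩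
    exact hZ q (hQ hq) k (congrArg Subtype.val hk)
  have h2 : Nat.card f.range * Nat.card f.ker = Nat.card A := by
    rw [← Subgroup.index_ker, mul_comm, Subgroup.card_mul_index]
  have h3 : Nat.card (D.map f) * Nat.card (D ⊓ f.ker : Subgroup A) = Nat.card D := by
    have h := Subgroup.card_mul_index (f.ker.subgroupOf D)
    rw [← Subgroup.card_map_of_injective D.subtype_injective, Subgroup.subgroupOf_map_subtype,
      inf_comm] at h
    rw [← h, mul_comm, ← Subgroup.relIndex_ker]
    rfl
  have h4 := Subgroup.card_mul_index D
  have h5 : ordProj[ℓ] (Nat.card f.range) * ordProj[ℓ] (Nat.card f.ker) =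
      Nat.card D * ordProj[ℓ] D.index := by
    rw [← Nat.ordProj_mul ℓ Nat.card_pos.ne' Nat.card_pos.ne', h2, ← h4,
      Nat.ordProj_mul ℓ Nat.card_pos.ne' (Subgroup.index_ne_zero_of_finite),
      ordProj_card_of_isPGroup hℓ hD]
  refine Nat.eq_of_mul_eq_mul_right (Nat.card_pos (α := (D ⊓ f.ker : Subgroup A))) ?_
  rw [mul_assoc, h3, h1, h5, mul_comm]

end Counting

/-! ### The congruence of character values -/

section Congruence

variable {𝔪 : Ideal AlgInt} {ℓ : ℕ}

/-- If the class size `s` is divisible by the `ℓ`-part of the degree `n`, then the reduction of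
the value `s v / n` of a central character determines that of the multiple `κ v` of the
character value, where `κ = s / n_ℓ`. -/
theorem natCast_mul_red_eq {n s κ : ℕ} (hn : n ≠ 0) (hs : s = ordProj[ℓ] n * κ) {v : ℂ}
    (hv : IsIntegral ℤ v) (h : IsIntegral ℤ (s * v / n)) :
    (κ : AlgInt ⧸ 𝔪) * red 𝔪 v = (ordCompl[ℓ] n : ℕ) * red 𝔪 (s * v / n) := by
  rw [← red_natCast, ← red_natCast, ← red_mul 𝔪 (isIntegral_natCast _) hv,
    ← red_mul 𝔪 (isIntegral_natCast _) h]
  congr 1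
  have h1 : (n : ℂ) = (ordProj[ℓ] n : ℕ) * (ordCompl[ℓ] n : ℕ) := by
    rw [← Nat.cast_mul, Nat.ordProj_mul_ordCompl_eq_self]
  have hn' : (n : ℂ) ≠ 0 := by exact_mod_cast hn
  have h2 : ((ordProj[ℓ] n : ℕ) : ℂ) ≠ 0 := by exact_mod_cast (Nat.ordProj_pos n ℓ).ne'
  have h3 : ((ordCompl[ℓ] n : ℕ) : ℂ) ≠ 0 := by
    intro h0; rw [h1, h0, mul_zero] at hn'; exact hn' rfl
  rw [hs]
  rw [h1]
  push_cast
  field_simp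

/-- A Sylow `ℓ`-subgroup of a subgroup of the image of `f` is the image of an `ℓ`-subgroup. -/
theorem exists_isPGroup_card_map_eq {M A : Type u} [Group M] [Group A] [Finite A] [Finite M]
    (hℓ : ℓ.Prime) (f : M →* A) (X : Subgroup A) (hX : X ≤ f.range) :
    ∃ R : Subgroup M, IsPGroup ℓ R ∧ R.map f ≤ X ∧
      Nat.card (R.map f) = ordProj[ℓ] (Nat.card X) := by
  have : Fact ℓ.Prime := ⟨hℓ⟩
  let g : X.comap f →* X := f.subgroupComap X
  have hg : Function.Surjective g := by
    rintro ⟨x, hx⟩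
    obtain ⟨m, rfl⟩ := hX hx
    exact ⟨⟨m, hx⟩, rfl⟩
  let T : Sylow ℓ (X.comap f) := default
  have h1 : ((T : Subgroup (X.comap f)).map (X.comap f).subtype).map f =
      ((T.mapSurjective hg : Sylow ℓ X) : Subgroup X).map X.subtype := by
    rw [Sylow.coe_mapSurjective, Subgroup.map_map, Subgroup.map_map]
    rfl
  refine ⟨(T : Subgroup (X.comap f)).map (X.comap f).subtype, T.2.map _, ?_, ?_⟩
  · rw [h1]; exact Subgroup.map_subtype_le _
  · rw [h1, Subgroup.card_map_of_injective X.subtype_injective]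
    exact (T.mapSurjective hg).card_eq_multiplicity

/-- The functions `χ` and `ψ` are not assumed to be irreducible characters here; they only share
their central characters with members of the blocks. -/
theorem IsInducedBlock.lam_eq {G : Type u} {H : Type v} [Group G] [Group H] {f : H →* G}
    {ψ : H → ℂ} {χ : G → ℂ} (h : IsInducedBlock 𝔪 f (bl 𝔪 ψ) (bl 𝔪 χ)) (K : ConjClasses G) :
    lam 𝔪 χ K = ∑ᶠ L ∈ {L : ConjClasses H | L.map f = K}, lam 𝔪 ψ L := by
  obtain ⟨⟨ψ', hψ', hψψ'⟩, ⟨χ', hχ', hχχ'⟩, h⟩ := h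
  have h1 : ψ' ∈ bl 𝔪 ψ := hψψ' ▸ ⟨hψ', rfl⟩
  have h2 : χ' ∈ bl 𝔪 χ := hχχ' ▸ ⟨hχ', rfl⟩
  rw [← h1.2, ← h2.2]
  exact h ψ' h1 χ' h2 K

variable {G A : Type u} [Group G] [Finite G] [Group A] {ι : G →* A} {D M : Subgroup G}

/-- The elements of `M̄ N_J(D̄)` that lie in `Ḡ` already lie in `M̄`. -/
theorem mem_map_of_mem_localSubgroup (hD : IsRadical ℓ D) (hker : ι.ker ≤ Subgroup.center G)
    (hDM : Subgroup.normalizer (D : Set G) ≤ M)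
    (hM : Subgroup.normalizer (D.map ι : Set A) ≤ Subgroup.normalizer (M.map ι : Set A))
    {J : Subgroup A} {x : A} (hx : x ∈ localSubgroup ι D M J) (hxG : x ∈ ι.range) :
    x ∈ M.map ι := by
  have h1 : x ∈ (M.map ι ⊔ (Subgroup.normalizer (D.map ι : Set A) ⊓ J) : Subgroup A) := hx
  rw [← SetLike.mem_coe, Subgroup.coe_mul_of_right_le_normalizer_left _ _ (inf_le_left.trans hM)]
    at h1
  obtain ⟨m, hm, y, hy, rfl⟩ := h1
  have hyG : y ∈ ι.range := by
    have := mul_mem (inv_mem (Subgroup.map_le_range ι M hm)) hxG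
    simpa using this
  obtain ⟨g, rfl⟩ := hyG
  exact mul_mem hm (Subgroup.mem_map_of_mem ι (hDM (hD.mem_normalizer_of_map_mem hker hy.1)))

/-- The values of the extensions `χ̃` and `χ̃'` at `a` are proportional modulo `𝔪` if `D̄` is a
Sylow subgroup of the centralizer of `a` in `Ḡ`: this is what the equality of central characters
for `J = Ḡ⟨a⟩` says at the class of `a`, because no other class of the local subgroup contributes
to the sum. -/
theorem red_character_congr [Finite A] [𝔪.IsMaximal] (hℓ : ℓ.Prime) (h𝔪 : (ℓ : AlgInt) ∈ 𝔪)
    (hD : IsRadical ℓ D) (hker : ι.ker ≤ Subgroup.center G) (hn : ι.range.Normal)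
    (hDM : Subgroup.normalizer (D : Set G) ≤ M)
    (hM : Subgroup.normalizer (D.map ι : Set A) ≤ Subgroup.normalizer (M.map ι : Set A))
    {n n' : ℕ} (R : Representation ℂ A (Fin n → ℂ))
    (R' : Representation ℂ (localSubgroup ι D M ⊤) (Fin n' → ℂ))
    {χ : G → ℂ} {χ' : M → ℂ} (hχ : χ ∈ Irr0 𝔪 ℓ D) (hχ' : χ' ∈ Irr0 𝔪 ℓ (D.subgroupOf M))
    (hR : ∀ g, R.character (ι g) = χ g)
    (hR' : ∀ m : M, R'.character ⟨ι m, map_le_localSubgroup ι D M ⊤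
      (Subgroup.mem_map_of_mem ι m.2)⟩ = χ' m)
    (hbl : ∀ (J : Subgroup A) (hJ : ι.range ≤ J),
        IsInducedBlock 𝔪 (Subgroup.inclusion (localSubgroup_le ι D M hJ))
          (bl 𝔪 fun h => R'.character (Subgroup.inclusion (localSubgroup_le_top ι D M J) h))
          (bl 𝔪 fun j : J => R.character j))
    (a : localSubgroup ι D M ⊤) (haD : ∀ d ∈ D, ι d * a = a * ι d)
    (hSyl : IsSylowIn ℓ (D.map ι) (ι.range ⊓ Subgroup.centralizer {(a : A)})) :
    ((ordCompl[ℓ] M.index * ordCompl[ℓ] n' : ℕ) : AlgInt ⧸ 𝔪) * red 𝔪 (R.character a) =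
      (ordCompl[ℓ] n : ℕ) * red 𝔪 (R'.character a) := by
  classical
  have hfact : Fact ℓ.Prime := ⟨hℓ⟩
  set Gb := ι.range with hGb
  set Mb := M.map ι with hMb
  set Db := D.map ι with hDb
  let J : Subgroup A := Gb ⊔ Subgroup.zpowers (a : A)
  have hGJ : Gb ≤ J := le_sup_left
  have haJ : (a : A) ∈ J := (le_sup_right : _ ≤ J) (Subgroup.mem_zpowers _)
  let H : Subgroup A := localSubgroup ι D M J
  have hMH : Mb ≤ H := map_le_localSubgroup ι D M J
  have hHJ : H ≤ J := localSubgroup_le ι D M hGJ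
  have hMG : Mb ≤ Gb := Subgroup.map_le_range ι M
  have hDMle : D ≤ M := Subgroup.le_normalizer.trans hDM
  have haN : (a : A) ∈ Subgroup.normalizer (Db : Set A) := by
    refine mem_normalizer_of_conj_mem ?_
    rintro _ ⟨d, hd, rfl⟩
    rw [← haD d hd, mul_inv_cancel_right]
    exact Subgroup.mem_map_of_mem ι hd
  have haH : (a : A) ∈ H := (le_sup_right : _ ≤ H) ⟨haN, haJ⟩
  have hJmem : ∀ g ∈ J, ∃ x ∈ Gb, ∃ i : ℤ, g = x * (a : A) ^ i := by
    intro g hg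
    rw [← SetLike.mem_coe, Subgroup.normal_mul] at hg
    obtain ⟨x, hx, _, ⟨i, rfl⟩, rfl⟩ := hg
    exact ⟨x, hx, i, rfl⟩
  -- the class of `a` in `J` is its `Ḡ`-orbit
  have horbJ : ∀ g ∈ J, ∃ x ∈ Gb, x⁻¹ * g * a = a * (x⁻¹ * g) := by
    intro g hg
    obtain ⟨x, hx, i, rfl⟩ := hJmem g hg
    refine ⟨x, hx, ?_⟩
    rw [inv_mul_cancel_left]
    exact ((Commute.refl (a : A)).zpow_left i).eq
  -- the class in `H` of an element fused to `a` is its `M̄`-orbit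
  have horbH : ∀ y ∈ H, ∀ b ∈ Gb, y = b * a * b⁻¹ →
      ∀ g ∈ H, ∃ x ∈ Mb, x⁻¹ * g * y = y * (x⁻¹ * g) := by
    intro y hy b hb hyb g hg
    obtain ⟨x, hx, i, hgx⟩ := hJmem g (hHJ hg)
    refine ⟨g * (y ^ i)⁻¹, ?_, ?_⟩
    · refine mem_map_of_mem_localSubgroup hD hker hDM hM (J := J)
        (mul_mem hg (inv_mem (zpow_mem hy i))) ?_
      have h1 : g * (y ^ i)⁻¹ = x * ((a : A) ^ i * b * ((a : A) ^ i)⁻¹) * b⁻¹ := by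
        rw [hyb, conj_zpow, hgx]; group
      rw [h1]
      exact mul_mem (mul_mem hx (hn.conj_mem b hb _)) (inv_mem hb)
    · have h1 : (g * (y ^ i)⁻¹)⁻¹ * g = y ^ i := by group
      rw [h1]
      exact ((Commute.refl y).zpow_left i).eq
  -- degrees
  have hχ1 : (n : ℂ) = χ 1 := by rw [← hR, map_one, character_one_eq]
  have hχ'1 : (n' : ℂ) = χ' 1 := by
    rw [← hR', ← character_one_eq R']
    congr 1
    exact Subtype.ext (by simp)
  have hn0 : n ≠ 0 := by
    have := one_ne_zero_of_mem_Irr hχ.1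
    rw [← hχ1] at this
    exact_mod_cast this
  have hn'0 : n' ≠ 0 := by
    have := one_ne_zero_of_mem_Irr hχ'.1
    rw [← hχ'1] at this
    exact_mod_cast this
  have hdeg : ordProj[ℓ] n * Nat.card Db = ordProj[ℓ] (Nat.card Gb) := by
    obtain ⟨-, -, d, hd, hd'⟩ := hχ
    have : n = d := by rw [← hχ1] at hd; exact_mod_cast hd
    rw [this, hd']
    exact ordProj_index_mul_card_map hℓ ι hD.1 fun z hz k hk => hD.mem_of_mem_center (hker hz) hk
  have hdeg' : ordProj[ℓ] n' * Nat.card Db = ordProj[ℓ] (Nat.card Mb) := by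
    obtain ⟨-, -, d, hd, hd'⟩ := hχ'
    have : n' = d := by rw [← hχ'1] at hd; exact_mod_cast hd
    rw [this, hd']
    have h1 := ordProj_index_mul_card_map hℓ (ι.comp M.subtype) (D := D.subgroupOf M)
      hD.1.comap_subtype fun z hz k hk =>
        hD.mem_of_mem_center (hker hz) (by simpa using congrArg Subtype.val hk)
    rwa [← Subgroup.map_map, Subgroup.subgroupOf_map_subtype, inf_eq_left.2 hDMle,
      MonoidHom.range_comp, Subgroup.range_subtype] at h1
  have hindex : Nat.card Gb = M.index * Nat.card Mb := by
    have h1 : Nat.card Gb * Nat.card ι.ker = Nat.card G := by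
      rw [← Subgroup.index_ker, mul_comm, Subgroup.card_mul_index]
    have h2 : Nat.card Mb * Nat.card ι.ker = Nat.card M := by
      have h3 := Subgroup.card_mul_index (ι.ker.subgroupOf M)
      have h4 : ι.ker ≤ M := hker.trans ((Subgroup.center_le_normalizer _).trans hDM)
      rw [Nat.card_congr (Subgroup.subgroupOfEquivOfLe h4).toEquiv] at h3
      rw [← h3, mul_comm, hMb, ← Subgroup.relIndex_ker]
      rfl
    refine Nat.eq_of_mul_eq_mul_right (Nat.card_pos (α := ι.ker)) ?_
    rw [h1, mul_assoc, h2, mul_comm, Subgroup.card_mul_index]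
  have hDbcard : Nat.card Db =
      ordProj[ℓ] (Nat.card (Gb ⊓ Subgroup.centralizer {(a : A)} : Subgroup A)) :=
    hSyl.card_eq hℓ
  have hDbp : IsPGroup ℓ Db := hD.1.map ι
  have hF : ∀ k : ℕ, k ≠ 0 → ((ordCompl[ℓ] k : ℕ) : AlgInt ⧸ 𝔪) ≠ 0 := fun k hk h0 =>
    Nat.not_dvd_ordCompl hℓ hk ((natCast_residue_eq_zero_iff 𝔪 hℓ h𝔪 _).1 h0)
  let ψ : H → ℂ := fun h => R'.character (Subgroup.inclusion (localSubgroup_le_top ι D M J) h)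
  let φ : J → ℂ := fun j => R.character j
  have hlamH : ∀ y : H, lam 𝔪 ψ (ConjClasses.mk y) =
      red 𝔪 ((ConjClasses.mk y).carrier.ncard * ψ y / n') := by
    intro y
    have h1 : ψ (Quotient.out (ConjClasses.mk y)) = ψ y :=
      character_eq_of_mk_eq (R'.comp (Subgroup.inclusion (localSubgroup_le_top ι D M J)))
        (mk_out _)
    have h2 : ψ 1 = n' := by
      rw [← character_one_eq R']
      exact congrArg R'.character (map_one _)
    rw [lam, h1, h2]
  have hlamJ : ∀ y : J, lam 𝔪 φ (ConjClasses.mk y) =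
      red 𝔪 ((ConjClasses.mk y).carrier.ncard * φ y / n) := by
    intro y
    have h1 : φ (Quotient.out (ConjClasses.mk y)) = φ y :=
      character_eq_of_mk_eq (R.comp J.subtype) (mk_out _)
    have h2 : φ 1 = n := character_one_eq R
    rw [lam, h1, h2]
  -- `|D̄| = |C_M̄(y)|_ℓ t`, and the `ℓ`-part of the class size of `y` is `χ'(1)_ℓ t` because
  -- `χ'` has height zero
  have hpart : ∀ y : H, ∀ b ∈ Gb, (y : A) = b * a * b⁻¹ → ∃ t, Nat.card Db =
      ordProj[ℓ] (Nat.card (Mb ⊓ Subgroup.centralizer {(y : A)} : Subgroup A)) * t ∧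
      (ConjClasses.mk y).carrier.ncard =
        ordProj[ℓ] n' * (t * ordCompl[ℓ] (ConjClasses.mk y).carrier.ncard) := by
    intro y b hb hyb
    have h1 := ncard_carrier_mul_card hMH y (horbH y y.2 b hb hyb)
    set c := Nat.card (Mb ⊓ Subgroup.centralizer {(y : A)} : Subgroup A) with hc
    set s := (ConjClasses.mk y).carrier.ncard with hs
    have hs0 : s ≠ 0 := by
      intro h0
      rw [h0, zero_mul] at h1
      exact Nat.card_pos.ne h1
    have hc0 : c ≠ 0 := Nat.card_pos.ne'
    have h2 : c ∣ Nat.card (Gb ⊓ Subgroup.centralizer {(a : A)} : Subgroup A) := by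
      rw [hc, ← Subgroup.card_map_of_injective (f := (MulAut.conj b⁻¹).toMonoidHom)
        (MulAut.conj b⁻¹).injective]
      refine Subgroup.card_dvd_of_le ?_
      rintro _ ⟨x, ⟨hx, hxy⟩, rfl⟩
      refine ⟨hn.conj_mem x (hMG hx) b⁻¹, ?_⟩
      replace hxy := Subgroup.mem_centralizer_singleton_iff.1 hxy
      rw [hyb] at hxy
      refine Subgroup.mem_centralizer_singleton_iff.2 ?_
      change b⁻¹ * x * b⁻¹⁻¹ * a = a * (b⁻¹ * x * b⁻¹⁻¹)
      calc b⁻¹ * x * b⁻¹⁻¹ * a = b⁻¹ * (x * (b * a * b⁻¹)) * b := by group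
        _ = _ := by rw [hxy]; group
    obtain ⟨t, ht⟩ := Nat.ordProj_dvd_ordProj_of_dvd Nat.card_pos.ne' h2 ℓ
    rw [← hDbcard] at ht
    refine ⟨t, ht, ?_⟩
    rw [← h1, Nat.ordProj_mul ℓ hs0 hc0, ht, mul_comm (ordProj[ℓ] c), ← mul_assoc] at hdeg'
    have h3 := Nat.eq_of_mul_eq_mul_right (Nat.ordProj_pos c ℓ) hdeg'
    rw [← mul_assoc, h3, Nat.ordProj_mul_ordCompl_eq_self]
  -- a class of `H` which contributes to the sum is the class of `a`
  have hkey : ∀ y : H, ∀ b ∈ Gb, (y : A) = b * a * b⁻¹ → lam 𝔪 ψ (ConjClasses.mk y) ≠ 0 →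
      ConjClasses.mk y = ConjClasses.mk (⟨a, haH⟩ : H) := by
    intro y b hb hyb hlam
    obtain ⟨t, ht, hst⟩ := hpart y b hb hyb
    rw [hlamH] at hlam
    have h1 := natCast_mul_red_eq (𝔪 := 𝔪) (v := ψ y) hn'0 hst (isIntegral_character R' _)
      (isIntegral_of_ne_zero 𝔪 hlam)
    have h2 := mul_ne_zero (hF n' hn'0) hlam
    rw [← h1] at h2
    have hκ := left_ne_zero_of_mul h2
    have hψ := right_ne_zero_of_mul h2
    -- `λ(y) ≠ 0` forces `t = 1`, i.e. the centralizer of `y` in `M̄` has a Sylow subgroup of order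
    -- `|D̄|`; it is conjugate to `D̄` because the value of the character at `y` does not vanish
    have ht1 : t = 1 := by
      have h3 : ¬ ℓ ∣ t := fun h => hκ ((natCast_residue_eq_zero_iff 𝔪 hℓ h𝔪 _).2 (h.mul_right _))
      obtain ⟨k, hk⟩ := IsPGroup.iff_card.1 hDbp
      obtain ⟨i, -, hi⟩ := (Nat.dvd_prime_pow hℓ).1 (hk ▸ ht ▸ dvd_mul_left t _)
      rcases i with _ | i
      · simpa using hi
      · exact absurd (hi ▸ dvd_pow_self ℓ i.succ_ne_zero) h3
    rw [ht1, mul_one] at ht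
    obtain ⟨P, hP, hPy, hPc⟩ := exists_isPGroup_card_map_eq hℓ (ι.comp M.subtype)
      (Mb ⊓ Subgroup.centralizer {(y : A)}) (by
        rw [MonoidHom.range_comp, Subgroup.range_subtype]; exact inf_le_left)
    rw [← ht] at hPc
    let j : M →* localSubgroup ι D M ⊤ := (ι.comp M.subtype).codRestrict _ fun m =>
      map_le_localSubgroup ι D M ⊤ (Subgroup.mem_map_of_mem ι m.2)
    obtain ⟨g, hg⟩ := exists_conj_le_of_red_character_ne_zero 𝔪 hℓ h𝔪 j R' hχ'.1 hR' hχ'.2.1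
      hψ hP fun r hr => Subtype.ext (by
        have := (hPy (Subgroup.mem_map_of_mem _ hr)).2
        replace this := Subgroup.mem_centralizer_singleton_iff.1 this
        exact this)
    -- `P` and `D` have images of the same order, so `g` conjugates one to the other
    have hPD : ((P.map (ι.comp M.subtype)).map (MulAut.conj (ι g)⁻¹).toMonoidHom) = Db := by
      refine Subgroup.eq_of_le_of_card_ge ?_ ?_
      · rintro _ ⟨_, ⟨r, hr, rfl⟩, rfl⟩
        refine ⟨_, hg r hr, ?_⟩
        simp
      · rw [Subgroup.card_map_of_injective (f := (MulAut.conj (ι g)⁻¹).toMonoidHom)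
          (MulAut.conj (ι g)⁻¹).injective, hPc]
    have hgM : ι g ∈ Mb := Subgroup.mem_map_of_mem ι g.2
    let b' : A := (ι g)⁻¹ * b
    have hb' : b' ∈ Gb := mul_mem (inv_mem (hMG hgM)) hb
    have hDy : ∀ d ∈ Db, d * (b' * a * b'⁻¹) = (b' * a * b'⁻¹) * d := by
      intro d hd
      rw [← hPD] at hd
      obtain ⟨r, hr, rfl⟩ := hd
      have h3 := (hPy hr).2
      replace h3 := Subgroup.mem_centralizer_singleton_iff.1 h3
      rw [hyb] at h3
      change (ι g)⁻¹ * r * (ι g)⁻¹⁻¹ * (b' * a * b'⁻¹) = b' * a * b'⁻¹ * ((ι g)⁻¹ * r * (ι g)⁻¹⁻¹)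
      calc (ι g)⁻¹ * r * (ι g)⁻¹⁻¹ * (b' * a * b'⁻¹) = (ι g)⁻¹ * (r * (b * a * b⁻¹)) * ι g := by
            simp only [b']; group
        _ = _ := by rw [h3]; simp only [b']; group
    -- now `D̄` centralizes both `a` and its conjugate under `b'`, so Sylow's theorem in `C_Ḡ(a)`
    -- replaces `b'` by an element `b' c` of the normalizer of `D̄`, which lies in `M̄`
    obtain ⟨c, ⟨hcG, hca⟩, hc⟩ := hSyl.exists_conj_le hℓ
      (P := Db.map (MulAut.conj b'⁻¹).toMonoidHom) (hDbp.map _) (by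
        rintro _ ⟨d, hd, rfl⟩
        refine ⟨hn.conj_mem d (Subgroup.map_le_range ι D hd) b'⁻¹, ?_⟩
        refine Subgroup.mem_centralizer_singleton_iff.2 ?_
        change b'⁻¹ * d * b'⁻¹⁻¹ * a = a * (b'⁻¹ * d * b'⁻¹⁻¹)
        calc b'⁻¹ * d * b'⁻¹⁻¹ * a = b'⁻¹ * (d * (b' * a * b'⁻¹)) * b' := by group
          _ = _ := by rw [hDy d hd]; group)
    replace hca := Subgroup.mem_centralizer_singleton_iff.1 hca
    have hm : b' * c ∈ Mb := by
      obtain ⟨x, hx⟩ := mul_mem hb' hcG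
      rw [← hx]
      refine Subgroup.mem_map_of_mem ι (hDM (hD.mem_normalizer_of_map_mem hker ?_))
      rw [hx, ← inv_mem_iff]
      refine mem_normalizer_of_conj_mem fun d hd => ?_
      have := hc _ (Subgroup.mem_map_of_mem _ hd)
      change c⁻¹ * (b'⁻¹ * d * b'⁻¹⁻¹) * c ∈ Db at this
      convert this using 1
      group
    rw [ConjClasses.mk_eq_mk_iff_isConj, isConj_comm, isConj_iff]
    refine ⟨⟨ι g * (b' * c), hMH (mul_mem hgM hm)⟩, Subtype.ext ?_⟩
    change ι g * (b' * c) * a * (ι g * (b' * c))⁻¹ = y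
    rw [hyb]
    calc ι g * (b' * c) * a * (ι g * (b' * c))⁻¹ = b * (c * a) * c⁻¹ * b⁻¹ := by
          simp only [b']; group
      _ = _ := by rw [hca]; group
  -- the equation of central characters at the class of `a`
  have hlam : lam 𝔪 φ (ConjClasses.mk ⟨a, haJ⟩) = lam 𝔪 ψ (ConjClasses.mk ⟨a, haH⟩) := by
    rw [(hbl J hGJ).lam_eq, finsum_eq_single _ (ConjClasses.mk (⟨a, haH⟩ : H))]
    · rw [finsum_eq_single _ (show ConjClasses.mk (⟨a, haH⟩ : H) ∈ _ from rfl) (by simp)]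
    · intro L hL
      rw [finsum_eq_if, ite_eq_right_iff]
      intro hLa
      by_contra h0
      induction L using Quotient.inductionOn with
      | h y =>
        obtain ⟨b, hb, hyb⟩ := exists_conj_of_mk_eq (⟨a, haJ⟩ : J)
          (Subgroup.inclusion hHJ y) horbJ hLa
        exact hL (hkey y b hb hyb h0)
  have hintJ : IsIntegral ℤ
      ((ConjClasses.mk (⟨a, haJ⟩ : J)).carrier.ncard * R.character a / n) := by
    have h1 := isIntegral_card_mul_div (ρ := (R.comp J.subtype : Representation ℂ J (Fin n → ℂ)))
      (ι.codRestrict J fun g => hGJ ⟨g, rfl⟩)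
      (by convert hχ.1 using 1; exact funext hR)
      (K := (ConjClasses.mk (⟨a, haJ⟩ : J)).carrier) (c := R.character a) (fun x k hk => by
        rw [ConjClasses.mem_carrier_iff_mk_eq] at hk ⊢
        rw [← hk, ConjClasses.mk_eq_mk_iff_isConj, isConj_comm]
        exact isConj_iff.2 ⟨_, rfl⟩) fun k hk => character_eq_of_mk_eq (R.comp J.subtype)
          (h := (⟨a, haJ⟩ : J)) (ConjClasses.mem_carrier_iff_mk_eq.1 hk)
    rwa [character_one_eq] at h1
  have hintH : IsIntegral ℤ
      ((ConjClasses.mk (⟨a, haH⟩ : H)).carrier.ncard * R'.character a / n') := by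
    have h1 := isIntegral_card_mul_div
      (ρ := (R'.comp (Subgroup.inclusion (localSubgroup_le_top ι D M J)) :
        Representation ℂ H (Fin n' → ℂ)))
      ((ι.comp M.subtype).codRestrict H fun m => hMH (Subgroup.mem_map_of_mem ι m.2))
      (by convert hχ'.1 using 1; exact funext hR')
      (K := (ConjClasses.mk (⟨a, haH⟩ : H)).carrier) (c := R'.character a) (fun x k hk => by
        rw [ConjClasses.mem_carrier_iff_mk_eq] at hk ⊢
        rw [← hk, ConjClasses.mk_eq_mk_iff_isConj, isConj_comm]
        exact isConj_iff.2 ⟨_, rfl⟩) fun k hk => character_eq_of_mk_eq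
          (R'.comp (Subgroup.inclusion (localSubgroup_le_top ι D M J)))
          (h := (⟨a, haH⟩ : H)) (ConjClasses.mem_carrier_iff_mk_eq.1 hk)
    rwa [character_one_eq] at h1
  rw [hlamH, hlamJ] at hlam
  change red 𝔪 (_ * R.character a / n) = red 𝔪 (_ * R'.character a / n') at hlam
  -- comparison of the sizes of the two classes
  have hcJ := ncard_carrier_mul_card hGJ (⟨a, haJ⟩ : J) horbJ
  have hcH := ncard_carrier_mul_card hMH (⟨a, haH⟩ : H) (horbH a haH 1 (one_mem _) (by simp))
  obtain ⟨t, ht, hst⟩ := hpart ⟨a, haH⟩ 1 (one_mem _) (by simp)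
  obtain ⟨k, hk, hk1⟩ := hSyl.exists_card_eq_mul hℓ
    (X := Mb ⊓ Subgroup.centralizer {(a : A)}) (inf_le_inf_right _ hMG) (by
      rintro x ⟨hx, ⟨g, rfl⟩, hxa⟩
      exact ⟨Subgroup.mem_map_of_mem ι (hDM (hD.mem_normalizer_of_map_mem hker hx)), hxa⟩)
  set cG := Nat.card (Gb ⊓ Subgroup.centralizer {(a : A)} : Subgroup A)
  set cM := Nat.card (Mb ⊓ Subgroup.centralizer {(a : A)} : Subgroup A) with hcM
  set s := (ConjClasses.mk (⟨a, haJ⟩ : J)).carrier.ncard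
  set s' := (ConjClasses.mk (⟨a, haH⟩ : H)).carrier.ncard
  change s * cG = _ at hcJ
  change s' * cM = _ at hcH
  change _ = ordProj[ℓ] cM * t at ht
  have hcM0 : cM ≠ 0 := Nat.card_pos.ne'
  have hcG0 : cG ≠ 0 := Nat.card_pos.ne'
  have hs0 : s ≠ 0 := by
    intro h0; rw [h0, zero_mul] at hcJ; exact Nat.card_pos.ne hcJ
  have hs'0 : s' ≠ 0 := by
    intro h0; rw [h0, zero_mul] at hcH; exact Nat.card_pos.ne hcH
  have hkl : ¬ ℓ ∣ k := fun h => hℓ.one_lt.ne' (Nat.dvd_one.1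
    ((Nat.modEq_zero_iff_dvd.1 (hk1.symm.trans (Nat.modEq_zero_iff_dvd.2 h)))))
  have hk0 : k ≠ 0 := by rintro rfl; exact hkl (dvd_zero _)
  have hpk : ordProj[ℓ] k = 1 := by
    rw [Nat.factorization_eq_zero_of_not_dvd hkl, pow_zero]
  have ht1 : t = 1 := by
    rw [hDbcard, hk, Nat.ordProj_mul ℓ hk0 hcM0, hpk, one_mul] at ht
    exact (Nat.eq_of_mul_eq_mul_left (Nat.ordProj_pos cM ℓ) (by rw [mul_one]; exact ht)).symm
  have hs : s = ordProj[ℓ] n * ordCompl[ℓ] s := by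
    rw [hDbcard, ← hcJ, Nat.ordProj_mul ℓ hs0 hcG0] at hdeg
    rw [Nat.eq_of_mul_eq_mul_right (Nat.ordProj_pos cG ℓ) hdeg, Nat.ordProj_mul_ordCompl_eq_self]
  have hs' : s' = ordProj[ℓ] n' * ordCompl[ℓ] s' := by
    rwa [ht1, one_mul] at hst
  have hss : s * k = M.index * s' := by
    refine Nat.eq_of_mul_eq_mul_right (Nat.pos_of_ne_zero hcM0) ?_
    rw [mul_assoc, ← hk, hcJ, hindex, mul_assoc, hcH]
  have hss' : ordCompl[ℓ] s * k = ordCompl[ℓ] M.index * ordCompl[ℓ] s' := by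
    rw [← Nat.ordCompl_mul, ← hss, Nat.ordCompl_mul, hpk, Nat.div_one]
  have hk1' : (k : AlgInt ⧸ 𝔪) = 1 := by
    have : CharP (AlgInt ⧸ 𝔪) ℓ := ⟨natCast_residue_eq_zero_iff 𝔪 hℓ h𝔪⟩
    exact_mod_cast (CharP.natCast_eq_natCast (AlgInt ⧸ 𝔪) ℓ).2 hk1
  have e1 := natCast_mul_red_eq (𝔪 := 𝔪) hn0 hs (isIntegral_character R a) hintJ
  have e2 := natCast_mul_red_eq (𝔪 := 𝔪) hn'0 hs' (isIntegral_character R' a) hintH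
  have e3 : ((ordCompl[ℓ] s : ℕ) : AlgInt ⧸ 𝔪) =
      (ordCompl[ℓ] M.index : ℕ) * (ordCompl[ℓ] s' : ℕ) := by
    rw [← Nat.cast_mul, ← hss', Nat.cast_mul, hk1', mul_one]
  rw [hlam] at e1
  refine mul_left_cancel₀ (hF s' hs'0) ?_
  rw [Nat.cast_mul]
  linear_combination ((ordCompl[ℓ] n' : ℕ) : AlgInt ⧸ 𝔪) * (e1 - e3 * red 𝔪 (R.character a)) -
    ((ordCompl[ℓ] n : ℕ) : AlgInt ⧸ 𝔪) * e2

end Congruence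

/-! ### Central characters of representations -/

section CentralCharacter

variable {C : Type u} [Group C] {W : Type v} [Group W] {n : ℕ}

/-- A central subgroup acts by a linear character, again by Schur's lemma. -/
theorem exists_centralChar [Finite W] {ρ : Representation ℂ W (Fin n → ℂ)}
    (hρ : ρ.character ∈ Irr W) (f : C →* W) (hf : ∀ z w, f z * w = w * f z) :
    ∃ ν : C →* ℂ, ∀ z, ρ (f z) = ν z • 1 := by
  have : NeZero n := ⟨ne_zero_of_character_mem_Irr hρ⟩
  have h1 : ∀ z, ∃ c : ℂ, ρ (f z) = c • 1 := fun z =>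
    exists_eq_smul_one_of_commute hρ _ fun g => by rw [← map_mul, hf, map_mul]
  choose ν hν using h1
  have hinj := smul_left_injective ℂ (one_ne_zero (α := Module.End ℂ (Fin n → ℂ)))
  refine ⟨⟨⟨ν, hinj ?_⟩, fun z w => hinj ?_⟩, hν⟩
  · change ν 1 • 1 = (1 : ℂ) • 1
    rw [← hν, map_one, map_one, one_smul]
  · change ν (z * w) • 1 = (ν z * ν w) • 1
    rw [← hν, map_mul, map_mul, hν, hν, smul_mul_smul_comm, one_mul]

theorem character_of_smul {ρ : Representation ℂ W (Fin n → ℂ)} {f : C →* W} {ν : C →* ℂ}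
    (h : ∀ z, ρ (f z) = ν z • 1) (z : C) : ρ.character (f z) = n * ν z := by
  rw [Representation.character, h, map_smul, LinearMap.trace_one, smul_eq_mul, mul_comm]
  simp

theorem linear_mem_Irr (ν : C →* ℂ) : (ν : C → ℂ) ∈ Irr C := by
  let ρ : Representation ℂ C (Fin 1 → ℂ) :=
    (algebraMap ℂ (Module.End ℂ (Fin 1 → ℂ))).toMonoidHom.comp ν
  refine ⟨1, ρ, ?_, ?_⟩
  · rw [Representation.irreducible_iff_isSimpleModule_asModule, isSimpleModule_iff]
    refine is_simple_module_of_finrank_eq_one (K := ℂ) ?_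
    rw [ρ.asModuleEquiv.finrank_eq]
    simp
  · ext z
    have h1 : ρ z = ν z • 1 :=
      Algebra.algebraMap_eq_smul_one (A := Module.End ℂ (Fin 1 → ℂ)) (ν z)
    rw [Representation.character, h1, map_smul, LinearMap.trace_one]
    simp

/-- Linear characters which are not orthogonal are equal. -/
theorem eq_of_sum_ne_zero [Fintype C] {ν ν' : C →* ℂ} (h : ∑ z, ν' z * ν z⁻¹ ≠ 0) : ν' = ν := by
  by_contra hne
  obtain ⟨y, hy⟩ : ∃ y, ν' y ≠ ν y := by
    by_contra! hall
    exact hne (MonoidHom.ext hall)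
  have h1 : ν' y * ν y⁻¹ * ∑ z, ν' z * ν z⁻¹ = ∑ z, ν' z * ν z⁻¹ := by
    rw [Finset.mul_sum]
    refine Fintype.sum_equiv (Equiv.mulLeft y) _ _ fun z => ?_
    simp only [Equiv.coe_mulLeft, mul_inv_rev, map_mul]
    ring
  have h2 : ν' y * ν y⁻¹ = 1 := mul_right_cancel₀ h (by rw [h1, one_mul])
  apply hy
  calc ν' y = ν' y * (ν y⁻¹ * ν y) := by rw [← map_mul, inv_mul_cancel, map_one, mul_one]
    _ = ν y := by rw [← mul_assoc, h2, one_mul]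

/-- Representations whose restrictions to a common central subgroup have the same constituents
have the same central character there. -/
theorem centralChar_eq_of_irrBelow_eq [Finite C] {W' : Type w} [Group W'] {n' : ℕ}
    {ρ : Representation ℂ W (Fin n → ℂ)} {ρ' : Representation ℂ W' (Fin n' → ℂ)} (hn : n ≠ 0)
    {f : C →* W} {f' : C →* W'} {ν ν' : C →* ℂ} (h : ∀ z, ρ (f z) = ν z • 1)
    (h' : ∀ z, ρ' (f' z) = ν' z • 1)
    (hbelow : irrBelow f ρ.character = irrBelow f' ρ'.character) : ν' = ν := by
  have : Fintype C := Fintype.ofFinite C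
  have hC : (Nat.card C : ℂ) ≠ 0 := by exact_mod_cast Nat.card_pos.ne'
  have hn' : (n : ℂ) ≠ 0 := by exact_mod_cast hn
  have h1 : (ν : C → ℂ) ∈ irrBelow f ρ.character := by
    refine ⟨linear_mem_Irr ν, ?_⟩
    have h2 : ∀ z, ρ.character (f z) * ν z⁻¹ = n := fun z => by
      rw [character_of_smul h, mul_assoc, ← map_mul, mul_inv_cancel, map_one, mul_one]
    rw [charInner, finsum_eq_sum_of_fintype]
    simp only [h2]
    simpa [← Nat.card_eq_fintype_card, hC] using hn'
  rw [hbelow] at h1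
  have h2 := h1.2
  rw [charInner, finsum_eq_sum_of_fintype] at h2
  simp only [character_of_smul h', mul_assoc] at h2
  rw [← Finset.mul_sum] at h2
  exact eq_of_sum_ne_zero (right_ne_zero_of_mul (right_ne_zero_of_mul h2))

end CentralCharacter

/-! ### From the automorphism group to the extension group -/

section Lifting

variable {G A : Type u} [Group G] [Group A] {ι : G →* A} {D M : Subgroup G} {ℓ : ℕ}

theorem IsSylowIn.le_of_le [Finite A] (hℓ : ℓ.Prime) {P H Q : Subgroup A} (h : IsSylowIn ℓ P H)
    (hQH : Q ≤ H) (hQ : IsPGroup ℓ Q) (hPQ : P ≤ Q) : Q ≤ P := by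
  obtain ⟨g, -, hg⟩ := h.exists_conj_le hℓ hQ hQH
  refine (Subgroup.eq_of_le_of_card_ge hPQ ?_).ge
  rw [← Subgroup.card_map_of_injective (f := (MulAut.conj g⁻¹).toMonoidHom)
    (MulAut.conj g⁻¹).injective]
  refine Subgroup.card_le_of_le ?_
  rintro _ ⟨q, hq, rfl⟩
  simpa using hg q hq

theorem mul_inv_mem_center_of_conj_eq {g h : G} (hgh : MulAut.conj g = MulAut.conj h) :
    h⁻¹ * g ∈ Subgroup.center G := by
  rw [Subgroup.mem_center_iff]
  intro x
  have h1 := DFunLike.congr_fun hgh x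
  simp only [MulAut.conj_apply] at h1
  calc x * (h⁻¹ * g) = h⁻¹ * (h * x * h⁻¹) * g := by group
    _ = h⁻¹ * g * x := by rw [← h1]; group

/-- If `a` is `ℓ`-regular, then a Sylow condition on the centralizer of the automorphism induced by
`a` lifts to the centralizer of `a`. -/
theorem isSylowIn_lift [Finite G] [Finite A] (hℓ : ℓ.Prime) (hD : IsRadical ℓ D)
    {Φ : A →* MulAut G} (hΦι : ∀ g, Φ (ι g) = MulAut.conj g) (hΦc : Φ.ker ≤ Subgroup.center A)
    {a : A} (ha : (orderOf a).Coprime ℓ)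
    (hS : IsSylowIn ℓ (D.map MulAut.conj)
      ((MulAut.conj : G →* MulAut G).range ⊓ Subgroup.centralizer {Φ a})) :
    (∀ d ∈ D, ι d * a = a * ι d) ∧
      IsSylowIn ℓ (D.map ι) (ι.range ⊓ Subgroup.centralizer {a}) := by
  have hle : D.map MulAut.conj ≤
      (MulAut.conj : G →* MulAut G).range ⊓ Subgroup.centralizer {Φ a} := by
    obtain ⟨T, hT⟩ := hS
    rw [← hT]
    exact Subgroup.map_subtype_le _
  have haD : ∀ d ∈ D, ι d * a = a * ι d := by
    intro d hd
    have h1 := Subgroup.mem_centralizer_singleton_iff.1 (hle (Subgroup.mem_map_of_mem _ hd)).2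
    obtain ⟨w, hw⟩ : ∃ w, w = a * ι d * a⁻¹ * (ι d)⁻¹ := ⟨_, rfl⟩
    have hwc : w ∈ Subgroup.center A := hΦc (by
      rw [MonoidHom.mem_ker, hw, map_mul, map_mul, map_mul, map_inv, map_inv, hΦι, ← h1]
      group)
    have hwc' := Subgroup.mem_center_iff.1 hwc
    have had : a * ι d * a⁻¹ = w * ι d := by rw [hw]; group
    have hpow : ∀ k : ℕ, a ^ k * ι d * (a ^ k)⁻¹ = w ^ k * ι d := by
      intro k
      induction k with
      | zero => simp
      | succ k ih =>
        calc a ^ (k + 1) * ι d * (a ^ (k + 1))⁻¹ = a * (a ^ k * ι d * (a ^ k)⁻¹) * a⁻¹ := by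
              rw [pow_succ']; group
          _ = (a * w ^ k) * ι d * a⁻¹ := by rw [ih]; group
          _ = w ^ k * (a * ι d * a⁻¹) := by
              rw [Subgroup.mem_center_iff.1 (pow_mem hwc k) a]; group
          _ = w ^ (k + 1) * ι d := by rw [had, ← mul_assoc, pow_succ]
    have hw1 : w ^ orderOf a = 1 := by
      have := hpow (orderOf a)
      rw [pow_orderOf_eq_one] at this
      simpa using this
    obtain ⟨j, hj⟩ := hD.exists_pow_eq_one hd
    have hj' : ι d ^ ℓ ^ j = 1 := by rw [← map_pow, hj, map_one]
    have hw2 : w ^ ℓ ^ j = 1 := by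
      have h2 : (a * ι d * a⁻¹) ^ ℓ ^ j = 1 := by rw [conj_pow, hj']; simp
      have hc : Commute w (ι d) := (hwc' (ι d)).symm
      rwa [had, hc.mul_pow, hj', mul_one] at h2
    have hw3 : w = 1 := by
      have h2 := Nat.dvd_gcd (orderOf_dvd_of_pow_eq_one hw1) (orderOf_dvd_of_pow_eq_one hw2)
      rw [Nat.Coprime.gcd_eq_one (ha.pow_right j), Nat.dvd_one, orderOf_eq_one_iff] at h2
      exact h2
    rw [hw3, one_mul, mul_inv_eq_iff_eq_mul] at had
    exact had.symm
  refine ⟨haD, isSylowIn_of_maximal ?_ (hD.1.map ι) fun Q hQ hQp hDQ q hq => ?_⟩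
  · rintro _ ⟨d, hd, rfl⟩
    exact ⟨⟨d, rfl⟩, Subgroup.mem_centralizer_singleton_iff.2 (haD d hd)⟩
  · have h1 : Q.map Φ ≤ D.map MulAut.conj := by
      refine hS.le_of_le hℓ ?_ (hQp.map Φ) ?_
      · rintro _ ⟨x, hx, rfl⟩
        obtain ⟨⟨g, rfl⟩, hxa⟩ := hQ hx
        refine ⟨⟨g, (hΦι g).symm⟩, Subgroup.mem_centralizer_singleton_iff.2 ?_⟩
        rw [← map_mul, ← map_mul, Subgroup.mem_centralizer_singleton_iff.1 hxa]
      · rintro _ ⟨d, hd, rfl⟩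
        exact ⟨ι d, hDQ (Subgroup.mem_map_of_mem ι hd), hΦι d⟩
    obtain ⟨⟨g, rfl⟩, -⟩ := hQ hq
    obtain ⟨k, hk⟩ := hQp ⟨_, hq⟩
    obtain ⟨e, he, j, hj⟩ := exists_pow_map_eq_of_pow_eq_one hℓ ι
      (show ι g ^ ℓ ^ k = 1 from congrArg Subtype.val hk)
    obtain ⟨d, hd, hdg⟩ := h1 (Subgroup.mem_map_of_mem Φ hq)
    have hz : d⁻¹ * g ^ e ∈ Subgroup.center G :=
      mul_inv_mem_center_of_conj_eq (by rw [← hΦι, he, hdg])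
    have h2 := hD.mul_mem_of_pow_eq_one hd hz (k := j) (by rwa [mul_inv_cancel_left])
    rw [mul_inv_cancel_left] at h2
    exact ⟨_, h2, he⟩

/-- The quotient of two units modulo `ℓ`, as a natural number between `1` and `ℓ - 1`. -/
theorem exists_residue_quotient (hℓ : ℓ.Prime) {r s : ℕ} (hr : ¬ ℓ ∣ r) (hs : ¬ ℓ ∣ s) :
    ∃ ε : ℕ, 1 ≤ ε ∧ ε < ℓ ∧ ε * r ≡ s [MOD ℓ] := by
  have : Fact ℓ.Prime := ⟨hℓ⟩
  have hr' : (r : ZMod ℓ) ≠ 0 := fun h => hr ((ZMod.natCast_eq_zero_iff _ _).1 h)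
  have hs' : (s : ZMod ℓ) ≠ 0 := fun h => hs ((ZMod.natCast_eq_zero_iff _ _).1 h)
  refine ⟨((s : ZMod ℓ) / r).val, ?_, ZMod.val_lt _, ?_⟩
  · rw [Nat.one_le_iff_ne_zero, Ne, ZMod.val_eq_zero]
    exact div_ne_zero hs' hr'
  · rw [← ZMod.natCast_eq_natCast_iff]
    push_cast
    rw [ZMod.natCast_zmod_val, div_mul_cancel₀ _ hr']

end Lifting

/-! ### Projective representations from extensions -/

section Projective

variable {G S : Type u} [Group G] [Group S] {ℓ : ℕ} {𝔪 : Ideal AlgInt}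

/-- A section of `Φ : A → Aut(G)` over its range which extends a given section of `G → Inn(G)`. -/
theorem exists_section {A : Type u} [Group A] {ι : G →* A} {Φ : A →* MulAut G}
    (hΦι : ∀ g, Φ (ι g) = MulAut.conj g) {rep : G ⧸ Subgroup.center G → G}
    (hrep : ∀ s, (rep s : G ⧸ Subgroup.center G) = s) :
    ∃ s : MulAut G → A, (∀ x ∈ Φ.range, Φ (s x) = x) ∧
      ∀ g : G, s (MulAut.conj g) = ι (rep g) := by
  classical
  have hconj : ∀ {g h : G}, MulAut.conj g = MulAut.conj h →
      (g : G ⧸ Subgroup.center G) = (h : G ⧸ Subgroup.center G) := fun hgh =>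
    (QuotientGroup.eq.2 (mul_inv_mem_center_of_conj_eq hgh)).symm
  have hconj' : ∀ g : G, MulAut.conj (rep g) = MulAut.conj g := by
    intro g
    have h1 := Subgroup.mem_center_iff.1 (QuotientGroup.eq.1 (hrep g))
    ext x
    calc rep g * x * (rep g)⁻¹ = rep g * (x * ((rep g)⁻¹ * g)) * g⁻¹ := by group
      _ = g * x * g⁻¹ := by rw [h1]; group
  let s : MulAut G → A := fun x =>
    if h : ∃ g, MulAut.conj g = x then ι (rep (h.choose : G))
    else if h : x ∈ Φ.range then h.choose else 1
  have hs : ∀ g : G, s (MulAut.conj g) = ι (rep g) := by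
    intro g
    have h : ∃ g', MulAut.conj g' = MulAut.conj g := ⟨g, rfl⟩
    simp only [s]
    rw [dif_pos h, hconj h.choose_spec]
  refine ⟨s, fun x hx => ?_, hs⟩
  by_cases h : ∃ g, MulAut.conj g = x
  · obtain ⟨g, rfl⟩ := h
    rw [hs, hΦι, hconj']
  · simp only [s]
    rw [dif_neg h, dif_pos hx]
    exact hx.choose_spec

theorem exists_pointed_section :
    ∃ rep : G ⧸ Subgroup.center G → G, (∀ s, (rep s : G ⧸ Subgroup.center G) = s) ∧ rep 1 = 1 := by
  classical
  refine ⟨fun s => if s = 1 then 1 else Quotient.out s, fun s => ?_, if_pos rfl⟩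
  by_cases h : s = 1
  · simp [h]
  · simp only [if_neg h]
    exact Quotient.out_eq s

theorem conj_mem_autStabChar {n : ℕ} {A : Type v} [Group A] {ι : G →* A}
    {ρ : Representation ℂ A (Fin n → ℂ)} {χ : G → ℂ} (hρ : ∀ g, ρ.character (ι g) = χ g)
    {a : A} {x : MulAut G} (hx : ∀ g, ι (x g) = a * ι g * a⁻¹) : x ∈ autStabChar χ := fun g => by
  rw [← hρ, hx, Representation.char_conj, hρ]

/-- The condition on extensions of ordinary characters implies the condition on projective
representations: a section `s` of `A → Aut(G)_χ` turns representations affording `χ̃` and `χ̃'` into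
projective representations, whose factor sets are both the common central character evaluated at
`s(x) s(y) s(xy)⁻¹`. -/
theorem projectiveCondition_of_extensionCondition [Finite G] [𝔪.IsMaximal] {π : G →* S}
    (hπ : IsUniversalCover π) (hπZ : π.ker = Subgroup.center G)
    (hZS : Subgroup.center S = ⊥) (hℓ : ℓ.Prime) (h𝔪 : (ℓ : AlgInt) ∈ 𝔪) {D M : Subgroup G}
    (hD : IsRadical ℓ D) {Ω : (G → ℂ) → (M → ℂ)} (hAM : IsAMBijection ℓ 𝔪 D M Ω) {χ : G → ℂ}
    (hχ : χ ∈ Irr0 𝔪 ℓ D) (h : ExtensionCondition 𝔪 D M χ (Ω χ)) :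
    ProjectiveCondition ℓ 𝔪 D M χ (Ω χ) := by
  classical
  obtain ⟨A, _, _, ι, hιker, hnorm, hcent, ⟨E⟩, ext, hext, ext', hext', hres, hres', hbl, hbelow⟩ :=
    h
  have hχ' : Ω χ ∈ Irr0 𝔪 ℓ (D.subgroupOf M) := hAM.bijOn.mapsTo hχ
  have hextI := hext
  have hextI' := hext'
  obtain ⟨n, R, -, rfl⟩ := hext
  obtain ⟨n', R', -, rfl⟩ := hext'
  have hn := ne_zero_of_character_mem_Irr hextI
  have hn' := ne_zero_of_character_mem_Irr hextI'
  have hker : ι.ker ≤ Subgroup.center G := fun g hg => ((hιker g).1 hg).1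
  obtain ⟨Φ, hΦ, hΦι, hΦone⟩ := hπ.exists_autHom hπZ hZS hker hnorm
  have hΦker : Φ.ker = Subgroup.center A := by
    ext a
    rw [MonoidHom.mem_ker, hΦone, hcent]
  -- the image of `A` in `Aut(G)` is the full stabilizer of `χ`, by comparison of orders
  have hΦrange : Φ.range = autStabChar χ := by
    refine Subgroup.eq_of_le_of_card_ge ?_ ?_
    · rintro _ ⟨a, rfl⟩
      exact conj_mem_autStabChar hres (hΦ a)
    · rw [← Nat.card_congr E.toEquiv, ← Subgroup.index_ker, hΦker]
      rfl
  have hΦD : ∀ a ∈ Subgroup.normalizer (D.map ι : Set A), ∀ d ∈ D, Φ a d ∈ D := by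
    intro a ha d hd
    obtain ⟨k, hk⟩ := hD.exists_pow_eq_one hd
    refine hD.mem_of_map_mem hker (k := k) ?_ (by rw [← map_pow, hk, map_one])
    rw [hΦ]
    exact (Subgroup.mem_normalizer_iff.1 ha _).1 (Subgroup.mem_map_of_mem ι hd)
  have hM : Subgroup.normalizer (D.map ι : Set A) ≤ Subgroup.normalizer (M.map ι : Set A) := by
    intro a ha
    have haD : Φ a ∈ autStab D := by
      intro g
      refine ⟨fun hg => ?_, hΦD a ha g⟩
      have := hΦD a⁻¹ (inv_mem ha) _ hg
      rwa [map_inv, MulAut.inv_apply_self] at this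
    refine mem_normalizer_of_conj_mem ?_
    rintro _ ⟨m, hm, rfl⟩
    rw [← hΦ]
    exact Subgroup.mem_map_of_mem ι (hAM.stable _ haD m hm)
  let L := localSubgroup ι D M ⊤
  have hZL : Subgroup.center A ≤ L := center_le_localSubgroup ι D M
  have hlocal : localAut D M χ ≤ autStabChar χ := by
    refine sup_le ?_ inf_le_right
    rintro _ ⟨m, -, rfl⟩
    rw [← hΦrange, ← hΦι]
    exact ⟨_, rfl⟩
  have hlocal' : localAut D M χ ≤ L.map Φ := by
    refine sup_le ?_ ?_
    · rintro _ ⟨m, hm, rfl⟩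
      exact ⟨ι m, map_le_localSubgroup ι D M ⊤ (Subgroup.mem_map_of_mem ι hm), hΦι m⟩
    · rintro x ⟨hxD, hx⟩
      rw [SetLike.mem_coe, ← hΦrange] at hx
      obtain ⟨a, rfl⟩ := hx
      refine ⟨a, (le_sup_right : _ ≤ L) ⟨mem_normalizer_of_conj_mem ?_, trivial⟩, rfl⟩
      rintro _ ⟨d, hd, rfl⟩
      rw [← hΦ]
      exact Subgroup.mem_map_of_mem ι ((hxD d).2 hd)
  obtain ⟨rep, hrep, hrep1⟩ := exists_pointed_section (G := G)
  obtain ⟨s, hs, hsι⟩ := exists_section hΦι hrep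
  rw [hΦrange] at hs
  have hΦeq : ∀ {a b : A}, Φ a = Φ b → a * b⁻¹ ∈ Subgroup.center A := fun hab => by
    rw [← hΦker, MonoidHom.mem_ker, map_mul, map_inv, hab, mul_inv_cancel]
  have hsL : ∀ x ∈ localAut D M χ, s x ∈ L := by
    intro x hx
    obtain ⟨a, ha, hax⟩ := hlocal' hx
    have h1 : s x * a⁻¹ ∈ Subgroup.center A := hΦeq (by rw [hs x (hlocal hx), hax])
    have h2 := mul_mem (hZL h1) ha
    rwa [inv_mul_cancel_right] at h2
  -- the common central character of the two extensions
  obtain ⟨ν, hν⟩ := exists_centralChar hextI (Subgroup.center A).subtype fun z w =>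
    (Subgroup.mem_center_iff.1 z.2 w).symm
  obtain ⟨ν', hν'⟩ := exists_centralChar hextI' (Subgroup.inclusion hZL) fun z w =>
    Subtype.ext (Subgroup.mem_center_iff.1 z.2 w).symm
  have hνν' : ν' = ν := centralChar_eq_of_irrBelow_eq hn hν hν' hbelow
  subst hνν'
  -- the factor set of both representations, with junk values off the stabilizer of `χ`
  let α : MulAut G → MulAut G → ℂ := fun x y =>
    if h : s x * s y * (s (x * y))⁻¹ ∈ Subgroup.center A then ν' ⟨_, h⟩ else 1
  have hfac : ∀ x ∈ autStabChar χ, ∀ y ∈ autStabChar χ,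
      s x * s y * (s (x * y))⁻¹ ∈ Subgroup.center A := fun x hx y hy => hΦeq (by
    rw [map_mul, hs x hx, hs y hy, hs _ (mul_mem hx hy)])
  have hroot : ∀ z, ∃ k : ℕ, 0 < k ∧ ν' z ^ k = 1 := fun z =>
    ⟨orderOf z, orderOf_pos z, by rw [← map_pow, pow_orderOf_eq_one, map_one]⟩
  let P' : MulAut G → (Module.End ℂ (Fin n' → ℂ))ˣ := fun x =>
    if h : s x ∈ L then MonoidHom.toHomUnits R' ⟨s x, h⟩ else 1
  have hP' : ∀ x (hx : s x ∈ L), (P' x : Module.End ℂ (Fin n' → ℂ)) = R' ⟨s x, hx⟩ := by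
    intro x hx
    simp only [P']
    rw [dif_pos hx]
    rfl
  let j : M →* L := (ι.comp M.subtype).codRestrict L fun m =>
    map_le_localSubgroup ι D M ⊤ (Subgroup.mem_map_of_mem ι m.2)
  refine ⟨n, n', rep, R.comp ι, R'.comp j, fun x => MonoidHom.toHomUnits R (s x), P', α, α, hrep,
    hrep1, funext hres, funext hres', ?_, ?_, ?_, ?_, fun _ _ _ _ => rfl, ?_⟩
  · intro x hx y hy
    have h1 := hfac x hx y hy
    have h2 : α x y = ν' ⟨_, h1⟩ := dif_pos h1
    rw [h2]
    refine ⟨?_, hroot _⟩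
    change R (s x) * R (s y) = ν' ⟨_, h1⟩ • R (s (x * y))
    have h3 := hν ⟨_, h1⟩
    rw [Subgroup.subtype_apply] at h3
    rw [← map_mul, ← one_mul (R (s (x * y))), ← smul_mul_assoc, ← h3, ← map_mul,
      inv_mul_cancel_right]
  · intro x hx y hy
    have h1 := hfac x (hlocal hx) y (hlocal hy)
    have h2 : α x y = ν' ⟨_, h1⟩ := dif_pos h1
    rw [h2]
    refine ⟨?_, hroot _⟩
    rw [hP' x (hsL x hx), hP' y (hsL y hy), hP' _ (hsL _ (mul_mem hx hy)), ← map_mul,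
      ← one_mul (R' ⟨s (x * y), _⟩), ← smul_mul_assoc, ← hν', ← map_mul]
    congr 1
    exact Subtype.ext (by simp)
  · intro g
    change R (s (MulAut.conj g)) = R (ι (rep g))
    rw [hsι]
  · intro m m' hm
    have h1 : s (MulAut.conj (m : G)) = ι m' := by rw [hsι, hm]
    have h2 : s (MulAut.conj (m : G)) ∈ L := h1 ▸ (j m').2
    rw [hP' _ h2]
    exact congrArg R' (Subtype.ext h1)
  · have hindex : M.index ≠ 0 := Subgroup.index_ne_zero_of_finite
    obtain ⟨ε, hε1, hεℓ, hε⟩ := exists_residue_quotient hℓ (Nat.not_dvd_ordCompl hℓ hn)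
      (s := ordCompl[ℓ] M.index * ordCompl[ℓ] n') (by
        rw [hℓ.dvd_mul, not_or]
        exact ⟨Nat.not_dvd_ordCompl hℓ hindex, Nat.not_dvd_ordCompl hℓ hn'⟩)
    refine ⟨ε, hε1, hεℓ, hε, fun x hx hxℓ hS => ?_⟩
    have hxs := hlocal hx
    rw [hP' x (hsL x hx)]
    change (ε : AlgInt ⧸ 𝔪) * red 𝔪 (R.character (s x)) = red 𝔪 (R'.character ⟨s x, hsL x hx⟩)
    -- replace the lift of `x` by its `ℓ`-regular part
    obtain ⟨e, he, heℓ⟩ := exists_pow_map_eq_of_coprime_orderOf hℓ Φ (a := s x)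
      (by rwa [hs x hxs])
    obtain ⟨a, ha⟩ : ∃ a : L, (a : A) = s x ^ e := ⟨⟨_, pow_mem (hsL x hx) e⟩, rfl⟩
    rw [← ha] at he heℓ
    rw [hs x hxs] at he
    obtain ⟨haD, haS⟩ := isSylowIn_lift hℓ hD hΦι hΦker.le heℓ (by rwa [he])
    have hcongr := red_character_congr hℓ h𝔪 hD hker hnorm hAM.normalizer_le hM R R' hχ hχ' hres
      hres' hbl a haD haS
    have hε' : (ε : AlgInt ⧸ 𝔪) * (ordCompl[ℓ] n : ℕ) =
        ((ordCompl[ℓ] M.index * ordCompl[ℓ] n' : ℕ) : AlgInt ⧸ 𝔪) := by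
      have : CharP (AlgInt ⧸ 𝔪) ℓ := ⟨natCast_residue_eq_zero_iff 𝔪 hℓ h𝔪⟩
      rw [← Nat.cast_mul]
      exact (CharP.natCast_eq_natCast (AlgInt ⧸ 𝔪) ℓ).2 hε
    have hne : ((ordCompl[ℓ] n : ℕ) : AlgInt ⧸ 𝔪) ≠ 0 := fun h0 =>
      Nat.not_dvd_ordCompl hℓ hn ((natCast_residue_eq_zero_iff 𝔪 hℓ h𝔪 _).1 h0)
    rw [← hε'] at hcongr
    have hmain : (ε : AlgInt ⧸ 𝔪) * red 𝔪 (R.character a) = red 𝔪 (R'.character a) := by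
      refine mul_left_cancel₀ hne ?_
      rw [← hcongr]
      ring
    -- `s x` and `a` differ by a central element, which acts by the same scalar in both
    -- representations
    have hz : s x * (a : A)⁻¹ ∈ Subgroup.center A := hΦeq (by rw [hs x hxs, he])
    have hνint : IsIntegral ℤ (ν' ⟨_, hz⟩) := by
      obtain ⟨k, hk, hk1⟩ := hroot ⟨_, hz⟩
      exact isIntegral_of_pow_eq_one hk.ne' hk1
    have e1 : R.character (s x) = ν' ⟨_, hz⟩ * R.character a := by
      have h1 := hν ⟨_, hz⟩
      rw [Subgroup.subtype_apply] at h1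
      have h2 : R (s x) = ν' ⟨_, hz⟩ • R a := by
        rw [← one_mul (R (a : A)), ← smul_mul_assoc, ← h1, ← map_mul, inv_mul_cancel_right]
      rw [Representation.character, h2, map_smul, smul_eq_mul]
      rfl
    have e2 : R'.character ⟨s x, hsL x hx⟩ = ν' ⟨_, hz⟩ * R'.character a := by
      have h2 : R' ⟨s x, hsL x hx⟩ = ν' ⟨_, hz⟩ • R' a := by
        rw [← one_mul (R' a), ← smul_mul_assoc, ← hν', ← map_mul]
        congr 1
        exact Subtype.ext (by simp)
      rw [Representation.character, h2, map_smul, smul_eq_mul]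
      rfl
    rw [e1, e2, red_mul 𝔪 hνint (isIntegral_character R _),
      red_mul 𝔪 hνint (isIntegral_character R' _), ← hmain]
    ring

end Projective

end InductiveAM

theorem mainTheorem3 (S G : Type u) [Group S] [Finite S] [IsSimpleGroup S]
    (hS : ∃ a b : S, a * b ≠ b * a)
    [Group G] (π : G →* S) (hπ : InductiveAM.IsUniversalCover π)
    (ℓ : ℕ) (hℓ : ℓ.Prime)
    (𝔪 : Ideal InductiveAM.AlgInt) [𝔪.IsMaximal] (h𝔪 : (ℓ : InductiveAM.AlgInt) ∈ 𝔪)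
    (h : ∀ Q : Subgroup S, InductiveAM.IsRadical ℓ Q →
      InductiveAM.RelativeInductiveAM ℓ 𝔪 π Q) :
    InductiveAM.InductiveAMCondition ℓ 𝔪 G := by
  have : Finite G := hπ.finite
  intro D hD hDZ
  obtain ⟨M, Ω, hAM, hext⟩ := h (D.map π) (hD.map hℓ hπ.1.1 hπ.1.2) D hD hDZ rfl
  exact ⟨M, Ω, hAM, fun χ hχ => InductiveAM.projectiveCondition_of_extensionCondition hπ
    (hπ.ker_eq_center hS) (InductiveAM.center_eq_bot hS) hℓ h𝔪 hD hAM hχ (hext χ hχ)⟩
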